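/- Let $\Omega\subset\mathbb R^3$ be a bounded Lipschitz domain, let $\varepsilon>0$, and put $\Omega_\varepsilon=\{x\in\Omega : \operatorname{dist}(x,\partial\Omega)>\varepsilon\}$. With $\mathbb H=\{z\in\mathbb C : \Im z>0\}$, let $\kappa\in C^\infty(\mathbb R;\overline{\mathbb H})$ be a strong attenuation coefficient, that is, $\kappa$ is non-zero and 1. every derivative of $\kappa$ is polynomially bounded: for each $\ell\in\mathbb N_0$ there are $\kappa_1>0$ and $N\in\mathbb N$ with $|\kappa^{(\ell)}(\omega)|\le\kappa_1(1+|\omega|)^N$ for all $\omega\in\mathbb R$; 2. $\kappa$ has a continuous extension $\tilde\kappa:\overline{\mathbb H}\to\overline{\mathbb H}$ which is holomorphic on $\mathbb H$ and satisfies $|\tilde\kappa(z)|\le\tilde\kappa_1(1+|z|)^{\tilde N}$ on $\overline{\mathbb H}$ for some $\tilde\kappa_1>0$, $\tilde N\in\mathbb N$; 3. $\kappa(-\omega)=-\overline{\kappa(\omega)}$ for all $\omega\in\mathbb R$; 4. for some $\kappa_0>0$, $\beta>0$ and $\omega_0\ge0$, $\Im\kappa(\omega)\ge\kappa_0|\omega|^\beta$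 for all $\omega\in\mathbb R$ with $|\omega|\ge\omega_0$. Fix such an exponent $\beta$, and let $N\in\mathbb N$ be an exponent for which the bound in 1. holds with $\ell=0$, that is, $|\kappa(\omega)|\le\kappa_1(1+|\omega|)^N$ for all $\omega\in\mathbb R$ and some $\kappa_1>0$. Then the integrated photoacoustic operator $$\check{\mathcal P}_\kappa:L^2(\Omega_\varepsilon)\to L^2(\mathbb R\times\partial\Omega),\qquad \check{\mathcal P}_\kappa h(\omega,\xi)=\frac1{4\pi\sqrt{2\pi}}\int_{\Omega_\varepsilon}\frac{\mathrm e^{\mathrm i\kappa(\omega)|\xi-y|}}{|\xi-y|}\,h(y)\,\mathrm dy,$$ is a well-defined bounded linear operator between these complex $L^2$ spaces (with the surface measure on $\partial\Omega$), $\check{\mathcal P}_\kappa^*\check{\mathcal P}_\kappa$ is compact, and there exist constants $C,c>0$ such that the eigenvalues $\lambda_1\ge\lambda_2\ge\dots\ge0$ of $\check{\mathcal P}_\kappa^*\check{\mathcal P}_\kappa$, listed in decreasing order with multiplicity (and continued by zeros if there are only finitely many positive ones), satisfy $$\lambda_n\le C\,n\,\sqrt[3]{n}\,\exp\left(-c\,n^{\frac{\beta}{3N}}\right)\qquad\text{for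 all } n\in\mathbb N,\ n\ge1.$$ -/

import Mathlib

open MeasureTheory
open scoped NNReal

noncomputable section

namespace AttenuatedPhotoacoustics

/-- Euclidean three-space. -/
abbrev E3 : Type := EuclideanSpace ℝ (Fin 3)

/-- A bounded Lipschitz domain in `ℝ³`: a bounded, nonempty, connected open set which, near each of
its boundary points and in suitable orthonormal coordinates `(x', x₃) ∈ ℝ² × ℝ`, is the set of
points lying strictly above the graph of a Lipschitz function. -/
structure IsBoundedLipschitzDomain (Ω : Set E3) : Prop where
  isOpen : IsOpen Ω
  isConnected : IsConnected Ω
  isBounded : Bornology.IsBounded Ω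
  lipschitz_boundary : ∀ p ∈ frontier Ω, ∃ r : ℝ, 0 < r ∧
    ∃ (Φ : E3 ≃ₗᵢ[ℝ] WithLp 2 (EuclideanSpace ℝ (Fin 2) × ℝ))
      (g : EuclideanSpace ℝ (Fin 2) → ℝ) (K : ℝ≥0), LipschitzWith K g ∧
      ∀ x ∈ Metric.ball p r, x ∈ Ω ↔ g (Φ x).fst < (Φ x).snd

/-- Attenuation coefficients: nonzero smooth functions `κ` from `ℝ` to the closed upper half plane,
all of whose derivatives are polynomially bounded, which extend to a polynomially bounded continuous
map of the closed upper half plane to itself that is holomorphic on the open upper half plane, and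
with the symmetry `κ (-ω) = -conj (κ ω)`. -/
structure IsAttenuationCoefficient (κ : ℝ → ℂ) : Prop where
  ne_zero : κ ≠ 0
  smooth : ContDiff ℝ ((⊤ : ℕ∞) : WithTop ℕ∞) κ
  im_nonneg : ∀ ω : ℝ, 0 ≤ (κ ω).im
  deriv_bound : ∀ l : ℕ, ∃ κ₁ : ℝ, 0 < κ₁ ∧ ∃ N : ℕ,
    ∀ ω : ℝ, ‖iteratedDeriv l κ ω‖ ≤ κ₁ * (1 + |ω|) ^ N
  extension : ∃ κt : ℂ → ℂ,
    ContinuousOn κt {z : ℂ | 0 ≤ z.im} ∧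
    (∀ z : ℂ, 0 ≤ z.im → 0 ≤ (κt z).im) ∧
    (∀ ω : ℝ, κt (ω : ℂ) = κ ω) ∧
    DifferentiableOn ℂ κt {z : ℂ | 0 < z.im} ∧
    ∃ κ₁ : ℝ, 0 < κ₁ ∧ ∃ N : ℕ, ∀ z : ℂ, 0 ≤ z.im → ‖κt z‖ ≤ κ₁ * (1 + ‖z‖) ^ N
  symm : ∀ ω : ℝ, κ (-ω) = -(starRingEnd ℂ) (κ ω)

/-- `|κ(ω)| ≤ κ₁ (1 + |ω|)^N` for all `ω`, with some constant `κ₁ > 0`. -/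
def HasGrowthExponent (κ : ℝ → ℂ) (N : ℕ) : Prop :=
  ∃ κ₁ : ℝ, 0 < κ₁ ∧ ∀ ω : ℝ, ‖κ ω‖ ≤ κ₁ * (1 + |ω|) ^ N

/-- `κ` is a strong attenuation coefficient with exponent `β > 0`: an attenuation coefficient with
`Im κ(ω) ≥ κ₀ |ω|^β` for all `|ω| ≥ ω₀`, for some constants `κ₀ > 0` and `ω₀ ≥ 0`. -/
structure IsStrongAttenuationCoefficient (κ : ℝ → ℂ) (β : ℝ) : Prop
    extends IsAttenuationCoefficient κ where
  exponent_pos : 0 < β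
  strong : ∃ κ₀ : ℝ, 0 < κ₀ ∧ ∃ ω₀ : ℝ, 0 ≤ ω₀ ∧
    ∀ ω : ℝ, ω₀ ≤ |ω| → κ₀ * |ω| ^ β ≤ (κ ω).im

/-- `Ω_ε`, the points of `Ω` at distance more than `ε` from the boundary. -/
def innerDomain (Ω : Set E3) (ε : ℝ) : Set E3 :=
  {x | x ∈ Ω ∧ ε < Metric.infDist x (frontier Ω)}

/-- The surface measure on `∂Ω` (two-dimensional Hausdorff measure, in the normalisation in which it
agrees with Lebesgue measure on the plane). -/
def surfaceMeasure (Ω : Set E3) : Measure E3 :=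
  (Measure.euclideanHausdorffMeasure 2 : Measure E3).restrict (frontier Ω)

/-- `L²(Ω_ε)`, complex valued. -/
abbrev SourceSpace (Ω : Set E3) (ε : ℝ) : Type :=
  Lp ℂ 2 ((volume : Measure E3).restrict (innerDomain Ω ε))

/-- `L²(ℝ × ∂Ω)`, complex valued. -/
abbrev DataSpace (Ω : Set E3) : Type :=
  Lp ℂ 2 ((volume : Measure ℝ).prod (surfaceMeasure Ω))

/-- The integral
`1 / (4 π √(2π)) ∫_{Ω_ε} exp (i κ(ω) |ξ - y|) / |ξ - y| h(y) dy`. -/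
def photoacousticIntegral (κ : ℝ → ℂ) (Ω : Set E3) (ε : ℝ) (h : E3 → ℂ) (ω : ℝ) (ξ : E3) : ℂ :=
  ((1 / (4 * Real.pi * Real.sqrt (2 * Real.pi)) : ℝ) : ℂ) *
    ∫ y in innerDomain Ω ε,
      Complex.exp (Complex.I * κ ω * (‖ξ - y‖ : ℂ)) / (‖ξ - y‖ : ℂ) * h y

/-- The bounded linear operator `P : L²(Ω_ε) → L²(ℝ × ∂Ω)` is the integrated photoacoustic operator
of `κ` in the frequency domain. This determines `P` uniquely. -/
def IsIntegratedPhotoacousticOperator (κ : ℝ → ℂ) (Ω : Set E3) (ε : ℝ)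
    (P : SourceSpace Ω ε →L[ℂ] DataSpace Ω) : Prop :=
  ∀ h : SourceSpace Ω ε, ∀ᵐ q ∂((volume : Measure ℝ).prod (surfaceMeasure Ω)),
    P h q = photoacousticIntegral κ Ω ε h q.1 q.2

/-- `lam 0 ≥ lam 1 ≥ …` lists the positive eigenvalues of `T` in decreasing order, each repeated
according to its (finite) multiplicity, and is continued by zeros if there are only finitely many of
them. -/
structure IsEigenvalueSequence {H : Type*} [NormedAddCommGroup H] [InnerProductSpace ℂ H]
    (T : H →L[ℂ] H) (lam : ℕ → ℝ) : Prop where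
  antitone : Antitone lam
  nonneg : ∀ n, 0 ≤ lam n
  multiplicity : ∀ μ : ℝ, 0 < μ →
    FiniteDimensional ℂ (Module.End.eigenspace (T : H →ₗ[ℂ] H) (μ : ℂ)) ∧
    {n : ℕ | lam n = μ}.Finite ∧
    {n : ℕ | lam n = μ}.ncard = Module.finrank ℂ (Module.End.eigenspace (T : H →ₗ[ℂ] H) (μ : ℂ))

end AttenuatedPhotoacoustics

end

noncomputable section

namespace AttenuatedPhotoacoustics

/-! The eigenvalue bound follows from the min-max principle: if `‖P h‖² ≤ t ‖h‖²` on the orthogonal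
complement of a space of dimension at most `n`, then `lam n ≤ t` (`exists_isEigenvalueSequence`).

The test spaces consist of piecewise polynomials on a fixed finite partition of `Ω_ε`. As a function
of `s = r²`, the kernel `exp (i k r) / r` is holomorphic near each `s = r₀² > 0`, so its Taylor
polynomial with `L` terms has error of order `exp (2 r₀ |k|) 2^(-L)` (`exists_kernel_approx`). Since
`|ξ - y|²` is a polynomial in `y`, these Taylor polynomials lie, for all `ω` and `ξ` at once, in one
space of dimension `O(L³)`, and they integrate to zero against every `h` orthogonal to it.

The error is useful only while `|κ(ω)|` is at most a small multiple of `L`, which holds if `(1 +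
|ω|)^N ≤ γ L`. At higher frequencies strong attenuation makes the kernel itself at most about `exp
(-b (1 + |ω|)^β)`, hence `exp (-b (γ L)^(β/N))` (`dichotomy`). Both regimes leave room for a factor
`1 / (1 + ω²)`, which gives square integrability in `ω`. Thus `‖P h‖` decays like `exp (-b
L^(β/N))`, and `n ~ L³` yields the exponent `β / (3N)`. -/

/-- A multiplicity function on the positive reals whose support is finite away from zero can be
listed as a decreasing sequence, continued by zeros. -/
theorem exists_antitone_enumeration (m : ℝ → ℕ)
    (hm : ∀ t : ℝ, 0 < t → {μ : ℝ | t ≤ μ ∧ m μ ≠ 0}.Finite) :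
    ∃ lam : ℕ → ℝ, Antitone lam ∧ (∀ n, 0 ≤ lam n) ∧
      (∀ μ : ℝ, 0 < μ → {n | lam n = μ}.Finite ∧ {n | lam n = μ}.ncard = m μ) ∧
      ∀ n, 0 < lam n → ∃ F : Finset ℝ, (∀ μ ∈ F, lam n ≤ μ) ∧ n < ∑ μ ∈ F, m μ := by
  classical
  let F : ℝ → Finset ℝ := fun t => if h : 0 < t then (hm t h).toFinset else ∅
  have hF : ∀ t, 0 < t → ∀ μ, μ ∈ F t ↔ t ≤ μ ∧ m μ ≠ 0 := by
    intro t ht μ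
    simp [F, ht]
  let D : ℝ → ℕ := fun t => ∑ μ ∈ F t, m μ
  -- `D t` counts the values `≥ t` with multiplicity; the `n`-th term is the largest value `μ` with
  -- `D μ > n`, or zero if there is none.
  let A : ℕ → Set ℝ := fun n => {μ | 0 < μ ∧ m μ ≠ 0 ∧ n < D μ}
  have hA : ∀ n, (A n).Nonempty → ∃ a, IsGreatest (A n) a := by
    rintro n ⟨t, ht⟩
    have hne : ((F t).filter (fun μ => n < D μ)).Nonempty :=
      ⟨t, Finset.mem_filter.2 ⟨(hF t ht.1 t).2 ⟨le_rfl, ht.2.1⟩, ht.2.2⟩⟩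
    have hmem := Finset.max'_mem _ hne
    set a := Finset.max' _ hne with ha
    rw [Finset.mem_filter, hF t ht.1] at hmem
    refine ⟨a, ⟨ht.1.trans_le hmem.1.1, hmem.1.2, hmem.2⟩, fun μ hμ => ?_⟩
    rcases le_total t μ with h | h
    · exact Finset.le_max' _ _ (Finset.mem_filter.2 ⟨(hF t ht.1 μ).2 ⟨h, hμ.2.1⟩, hμ.2.2⟩)
    · exact h.trans hmem.1.1
  let lam : ℕ → ℝ := fun n => if h : (A n).Nonempty then (hA n h).choose else 0
  have hlam : ∀ n, (A n).Nonempty → IsGreatest (A n) (lam n) := by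
    intro n h
    simp only [lam, h, dif_pos]
    exact (hA n h).choose_spec
  have hlam0 : ∀ n, ¬ (A n).Nonempty → lam n = 0 := fun n h => by simp only [lam, h, dif_neg,
    not_false_eq_true]
  have hnonneg : ∀ n, 0 ≤ lam n := by
    intro n
    by_cases h : (A n).Nonempty
    · exact (hlam n h).1.1.le
    · exact (hlam0 n h).ge
  have hpos : ∀ n, 0 < lam n → IsGreatest (A n) (lam n) := by
    intro n h
    by_contra hc
    exact h.ne' (hlam0 n fun hne => hc (hlam n hne))
  have hD : ∀ μ, 0 < μ → D μ = m μ + ∑ ν ∈ (F μ).erase μ, m ν := by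
    intro μ hμ
    by_cases h : m μ = 0
    · have : μ ∉ F μ := fun hc => ((hF μ hμ μ).1 hc).2 h
      rw [Finset.erase_eq_of_notMem this, h, zero_add]
    · exact (Finset.add_sum_erase _ _ ((hF μ hμ μ).2 ⟨le_rfl, h⟩)).symm
  refine ⟨lam, ?_, hnonneg, ?_, ?_⟩
  · intro k n hkn
    by_cases h : (A n).Nonempty
    · have hsub : A n ⊆ A k := fun μ hμ => ⟨hμ.1, hμ.2.1, hkn.trans_lt hμ.2.2⟩
      exact (hlam k (h.mono hsub)).2 (hsub (hlam n h).1)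
    · rw [hlam0 n h]
      exact hnonneg k
  · intro μ hμ
    -- The value `μ` occupies the indices from the number of strictly larger values up to `D μ`, a
    -- block of length `m μ`.
    have key : {n | lam n = μ} = Set.Ico (∑ ν ∈ (F μ).erase μ, m ν) (D μ) := by
      ext n
      constructor
      · rintro rfl
        have hg := hpos n hμ
        refine ⟨?_, hg.1.2.2⟩
        by_contra! hlt
        have hne : ((F (lam n)).erase (lam n)).Nonempty := by
          by_contra hc
          rw [Finset.not_nonempty_iff_eq_empty.1 hc] at hlt
          simp at hlt
        have hmem := Finset.min'_mem _ hne
        set ν := Finset.min' _ hne with hν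
        rw [Finset.mem_erase, hF _ hμ] at hmem
        have hlt' : lam n < ν := lt_of_le_of_ne hmem.2.1 hmem.1.symm
        have hν0 : 0 < ν := hμ.trans hlt'
        have hFν : F ν = (F (lam n)).erase (lam n) := by
          ext x
          rw [hF ν hν0, Finset.mem_erase, hF _ hμ]
          constructor
          · rintro ⟨h1, h2⟩
            exact ⟨(hlt'.trans_le h1).ne', (hlt'.le.trans h1), h2⟩
          · rintro ⟨h1, h2, h3⟩
            exact ⟨Finset.min'_le _ _ (Finset.mem_erase.2 ⟨h1, (hF _ hμ x).2 ⟨h2, h3⟩⟩), h3⟩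
        have : ν ∈ A n := ⟨hν0, hmem.2.2, by simpa only [D, hFν] using hlt⟩
        exact absurd (hg.2 this) (not_le.2 hlt')
      · rintro ⟨h1, h2⟩
        have hm0 : m μ ≠ 0 := by
          intro h0
          rw [hD μ hμ, h0, zero_add] at h2
          exact absurd h1 (not_le.2 h2)
        have hg : IsGreatest (A n) μ := by
          refine ⟨⟨hμ, hm0, h2⟩, fun ν hν => ?_⟩
          by_contra! hlt
          have hsub : F ν ⊆ (F μ).erase μ := by
            intro x hx
            rw [hF ν hν.1] at hx
            exact Finset.mem_erase.2 ⟨(hlt.trans_le hx.1).ne',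
              (hF μ hμ x).2 ⟨hlt.le.trans hx.1, hx.2⟩⟩
          have := Finset.sum_le_sum_of_subset (f := m) hsub
          exact absurd (hν.2.2.trans_le (this.trans h1)) (lt_irrefl _)
        exact (hlam n ⟨μ, hg.1⟩).unique hg
    rw [key]
    refine ⟨Set.finite_Ico _ _, ?_⟩
    rw [← Finset.coe_Ico, Set.ncard_coe_finset, Nat.card_Ico, hD μ hμ, Nat.add_sub_cancel]
  · intro n hn
    have hg := hpos n hn
    exact ⟨F (lam n), fun μ hμ => ((hF _ hn μ).1 hμ).1, hg.1.2.2⟩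

/-! ### Min-max principle and compactness. -/

section Spectral

variable {H K : Type*} [NormedAddCommGroup H] [InnerProductSpace ℂ H]
  [NormedAddCommGroup K] [InnerProductSpace ℂ K] [CompleteSpace K]

/-- If `‖P h‖² ≤ s ‖h‖²` with `s < t` on the orthogonal complement of a finite
dimensional space `V`, then finitely many eigenspaces of `P* P` for eigenvalues at least `t` embed jointly into `V`. -/
theorem exists_injective_eigenspaces [CompleteSpace H] (P : H →L[ℂ] K) (V : Submodule ℂ H) [FiniteDimensional ℂ V]
    {s t : ℝ} (hst : s < t) (hV : ∀ h ∈ Vᗮ, ‖P h‖ ^ 2 ≤ s * ‖h‖ ^ 2)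
    (F : Finset ℝ) (hF : ∀ μ ∈ F, t ≤ μ) :
    ∃ f : ((μ : F) → Module.End.eigenspace
        ((ContinuousLinearMap.adjoint P ∘L P : H →L[ℂ] H) : H →ₗ[ℂ] H) ((μ : ℝ) : ℂ)) →ₗ[ℂ] V,
      Function.Injective f := by
  classical
  set T : H →L[ℂ] H := ContinuousLinearMap.adjoint P ∘L P with hT
  have hsymm : (T : H →ₗ[ℂ] H).IsSymmetric := by
    intro x y
    simp [hT, ContinuousLinearMap.adjoint_inner_left, ContinuousLinearMap.adjoint_inner_right]
  have hTx : ∀ x, inner ℂ (T x) x = ((‖P x‖ ^ 2 : ℝ) : ℂ) := by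
    intro x
    simp [hT, ContinuousLinearMap.adjoint_inner_left]
  let sumMap : ((μ : F) → Module.End.eigenspace (T : H →ₗ[ℂ] H) ((μ : ℝ) : ℂ)) →ₗ[ℂ] H :=
    ∑ μ : F, (Submodule.subtype _).comp (LinearMap.proj μ)
  have hsum : ∀ x, sumMap x = ∑ μ, (x μ : H) := by
    intro x
    simp [sumMap]
  refine ⟨(V.orthogonalProjectionOnto : H →ₗ[ℂ] V).comp sumMap, ?_⟩
  rw [← LinearMap.ker_eq_bot, LinearMap.ker_eq_bot']
  intro x hx
  have hmem : sumMap x ∈ Vᗮ := by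
    rw [← Submodule.orthogonalProjectionOnto_eq_zero_iff]
    exact hx
  have horth : ∀ μ ν : F, μ ≠ ν → inner ℂ (x μ : H) (x ν : H) = 0 := by
    intro μ ν hne
    have hne' : ((μ : ℝ) : ℂ) ≠ ((ν : ℝ) : ℂ) := by
      intro h
      exact hne (Subtype.ext (Complex.ofReal_injective h))
    exact hsymm.orthogonalFamily_eigenspaces hne' (x μ) (x ν)
  have hTs : T (sumMap x) = ∑ μ : F, ((μ : ℝ) : ℂ) • (x μ : H) := by
    rw [hsum, map_sum]
    exact Finset.sum_congr rfl fun μ _ => Module.End.mem_eigenspace_iff.1 (x μ).2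
  have h1 : ‖P (sumMap x)‖ ^ 2 = ∑ μ : F, (μ : ℝ) * ‖(x μ : H)‖ ^ 2 := by
    have := hTx (sumMap x)
    rw [hTs, hsum, sum_inner] at this
    have h2 : ∀ μ : F, inner ℂ (((μ : ℝ) : ℂ) • (x μ : H)) (∑ ν, (x ν : H)) =
        (((μ : ℝ) * ‖(x μ : H)‖ ^ 2 : ℝ) : ℂ) := by
      intro μ
      rw [inner_smul_left, inner_sum, Finset.sum_eq_single μ (fun ν _ h => horth μ ν h.symm)
        (by simp), inner_self_eq_norm_sq_to_K]
      simp
    rw [Finset.sum_congr rfl fun μ _ => h2 μ, ← Complex.ofReal_sum] at this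
    rw [hsum]
    exact (Complex.ofReal_injective this).symm
  have h3 : ‖sumMap x‖ ^ 2 = ∑ μ : F, ‖(x μ : H)‖ ^ 2 := by
    have h4 : ((‖sumMap x‖ ^ 2 : ℝ) : ℂ) = ((∑ μ : F, ‖(x μ : H)‖ ^ 2 : ℝ) : ℂ) := by
      have := inner_self_eq_norm_sq_to_K (𝕜 := ℂ) (sumMap x)
      rw [Complex.ofReal_pow]
      refine this.symm.trans ?_
      rw [hsum, sum_inner, Complex.ofReal_sum]
      refine Finset.sum_congr rfl fun μ _ => ?_
      rw [inner_sum, Finset.sum_eq_single μ (fun ν _ h => horth μ ν h.symm)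
        (by simp), inner_self_eq_norm_sq_to_K]
      simp
    exact Complex.ofReal_injective h4
  -- By orthogonality of eigenvectors, the form is at least `t` on the sum of the eigenspaces but at
  -- most `s < t` on `Vᗮ`; so projection to `V` has trivial kernel there.
  have h5 : t * ‖sumMap x‖ ^ 2 ≤ ‖P (sumMap x)‖ ^ 2 := by
    rw [h1, h3, Finset.mul_sum]
    exact Finset.sum_le_sum fun μ _ => mul_le_mul_of_nonneg_right (hF μ μ.2) (by positivity)
  have h6 : ‖sumMap x‖ ^ 2 ≤ 0 := by
    have := h5.trans (hV _ hmem)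
    nlinarith [sq_nonneg ‖sumMap x‖]
  rw [h3] at h6
  have h7 := (Finset.sum_eq_zero_iff_of_nonneg (fun μ _ => by positivity)).1
    (le_antisymm h6 (Finset.sum_nonneg fun μ _ => by positivity))
  funext μ
  simpa using h7 μ (Finset.mem_univ μ)

/-- `P` is the norm limit of the finite-rank operators obtained by first projecting to `V`. -/
theorem isCompactOperator_of_finiteDimensional_approx (P : H →L[ℂ] K)
    (hP : ∀ t : ℝ, 0 < t → ∃ V : Submodule ℂ H, FiniteDimensional ℂ V ∧
      ∀ h ∈ Vᗮ, ‖P h‖ ^ 2 ≤ t * ‖h‖ ^ 2) :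
    IsCompactOperator P := by
  have hcl := isClosed_setOfPred_isCompactOperator (σ₁₂ := RingHom.id ℂ) (M₁ := H) (M₂ := K)
  have : P ∈ closure {f : H →L[ℂ] K | IsCompactOperator f} := by
    rw [Metric.mem_closure_iff]
    intro e he
    obtain ⟨V, hfin, hV⟩ := hP ((e / 2) ^ 2) (by positivity)
    refine ⟨P ∘L V.starProjection, ?_, ?_⟩
    · have hc : IsCompactOperator (V.orthogonalProjectionOnto : H →L[ℂ] V) := by
        have : ProperSpace V := FiniteDimensional.proper ℂ V
        refine ⟨Metric.closedBall 0 1, isCompact_closedBall 0 1, ?_⟩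
        exact V.orthogonalProjectionOnto.continuous.continuousAt.preimage_mem_nhds
          (by simpa using Metric.closedBall_mem_nhds (0 : V) one_pos)
      exact hc.clm_comp (P ∘L V.subtypeL)
    · rw [dist_eq_norm]
      refine lt_of_le_of_lt (ContinuousLinearMap.opNorm_le_bound _ (M := e / 2) (by positivity)
        fun h => ?_) (half_lt_self he)
      have hmem : h - V.starProjection h ∈ Vᗮ := Submodule.sub_starProjection_mem_orthogonal h
      have h1 := hV _ hmem
      have h2 : ‖h - V.starProjection h‖ ≤ ‖h‖ := by
        have hp := Submodule.norm_sq_eq_add_norm_sq_starProjection h V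
        rw [Submodule.starProjection_orthogonal_val] at hp
        nlinarith [norm_nonneg h, sq_nonneg ‖V.starProjection h‖,
          norm_nonneg (h - V.starProjection h)]
      have h3 : (P - P ∘L V.starProjection) h = P (h - V.starProjection h) := by simp
      rw [h3]
      rw [← mul_pow] at h1
      exact (abs_le_of_sq_le_sq' h1 (by positivity)).2.trans (by gcongr)
  rw [hcl.closure_eq] at this
  exact this

/-- The decreasing sequence of eigenvalues of `P* P` exists, and its `n`-th term is bounded by any
bound for `‖P h‖² / ‖h‖²` on the orthogonal complement of a space of dimension at most `n`. -/
theorem exists_isEigenvalueSequence [CompleteSpace H] (P : H →L[ℂ] K)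
    (hP : ∀ t : ℝ, 0 < t → ∃ V : Submodule ℂ H, FiniteDimensional ℂ V ∧
      ∀ h ∈ Vᗮ, ‖P h‖ ^ 2 ≤ t * ‖h‖ ^ 2) :
    ∃ lam : ℕ → ℝ, IsEigenvalueSequence (ContinuousLinearMap.adjoint P ∘L P) lam ∧
      ∀ (n : ℕ) (t : ℝ) (V : Submodule ℂ H), 0 ≤ t → FiniteDimensional ℂ V →
        Module.finrank ℂ V ≤ n → (∀ h ∈ Vᗮ, ‖P h‖ ^ 2 ≤ t * ‖h‖ ^ 2) → lam n ≤ t := by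
  classical
  set T : H →L[ℂ] H := ContinuousLinearMap.adjoint P ∘L P with hT
  let E : ℝ → Submodule ℂ H := fun μ => Module.End.eigenspace (T : H →ₗ[ℂ] H) (μ : ℂ)
  have hfin : ∀ μ : ℝ, 0 < μ → FiniteDimensional ℂ (E μ) := by
    intro μ hμ
    obtain ⟨V, hfd, hV⟩ := hP (μ / 2) (by positivity)
    obtain ⟨f, hf⟩ := exists_injective_eigenspaces P V (half_lt_self hμ) hV {μ} (by simp)
    have h1 := FiniteDimensional.of_injective f hf
    let i : ({μ} : Finset ℝ) := ⟨μ, by simp⟩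
    exact FiniteDimensional.of_injective
      (LinearMap.single ℂ (fun ν : ({μ} : Finset ℝ) => E ν) i) (fun a b h => Pi.single_injective i h)
  have hcard : ∀ (s t : ℝ) (V : Submodule ℂ H), 0 < t → s < t → FiniteDimensional ℂ V →
      (∀ h ∈ Vᗮ, ‖P h‖ ^ 2 ≤ s * ‖h‖ ^ 2) → ∀ F : Finset ℝ, (∀ μ ∈ F, t ≤ μ) →
      ∑ μ ∈ F, Module.finrank ℂ (E μ) ≤ Module.finrank ℂ V := by
    intro s t V ht hst hfd hV F hF
    obtain ⟨f, hf⟩ := exists_injective_eigenspaces P V hst hV F hF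
    have : ∀ μ : F, FiniteDimensional ℂ (E μ) := fun μ => hfin μ (ht.trans_le (hF μ μ.2))
    have := LinearMap.finrank_le_finrank_of_injective hf
    rw [Module.finrank_pi_fintype] at this
    rwa [← Finset.sum_coe_sort]
  obtain ⟨lam, hanti, hnn, hmult, hex⟩ := exists_antitone_enumeration
    (fun μ => Module.finrank ℂ (E μ)) (by
      intro t ht
      obtain ⟨V, hfd, hV⟩ := hP (t / 2) (by positivity)
      -- More than `dim V` distinct eigenvalues `≥ t` would have total multiplicity exceeding `dim
      -- V`.
      by_contra hinf
      obtain ⟨F, hFs, hFc⟩ := Set.Infinite.exists_subset_card_eq hinf (Module.finrank ℂ V + 1)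
      have h1 := hcard _ _ V ht (half_lt_self ht) hfd hV F fun μ hμ => (hFs hμ).1
      have h2 : ∑ μ ∈ F, 1 ≤ ∑ μ ∈ F, Module.finrank ℂ (E μ) :=
        Finset.sum_le_sum fun μ hμ => Nat.one_le_iff_ne_zero.2 (hFs hμ).2
      simp only [Finset.sum_const, smul_eq_mul, mul_one] at h2
      omega)
  refine ⟨lam, ⟨hanti, hnn, fun μ hμ => ⟨hfin μ hμ, hmult μ hμ⟩⟩, ?_⟩
  intro n t V ht hfd hn hV
  by_contra! hlt
  obtain ⟨F, hF, hlt'⟩ := hex n (ht.trans_lt hlt)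
  exact absurd (hcard _ _ V (ht.trans_lt hlt) hlt hfd hV F hF) (by omega)

end Spectral

/-! ### Finiteness of the surface measure. -/

/-- A boundary point is not strictly above the graph because `Ω` is open, nor strictly below, where
a neighbourhood would miss `Ω`. So it lies on the graph, a Lipschitz image of a planar ball. -/
theorem IsBoundedLipschitzDomain.exists_frontier_inter_ball_subset {Ω : Set E3}
    (hΩ : IsBoundedLipschitzDomain Ω) {p : E3} (hp : p ∈ frontier Ω) :
    ∃ r : ℝ, 0 < r ∧ ∃ (f : EuclideanSpace ℝ (Fin 2) → E3) (C : ℝ≥0) (R : ℝ), LipschitzWith C f ∧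
      frontier Ω ∩ Metric.ball p r ⊆ f '' Metric.ball 0 R := by
  obtain ⟨r, hr, Φ, g, K, hg, hx⟩ := hΩ.lipschitz_boundary p hp
  let G : EuclideanSpace ℝ (Fin 2) → EuclideanSpace ℝ (Fin 2) × ℝ := fun u => (u, g u)
  have hG : LipschitzWith (max 1 K) G := LipschitzWith.id.prodMk hg
  have hto := WithLp.prod_lipschitzWith_toLp 2 (EuclideanSpace ℝ (Fin 2)) ℝ
  refine ⟨r, hr, fun u => Φ.symm (WithLp.toLp 2 (G u)), _, ‖p‖ + r,
    Φ.symm.lipschitz.comp (hto.comp hG), ?_⟩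
  rintro x ⟨hxf, hxb⟩
  have hcont1 : Continuous fun y => (Φ y).snd := by
    exact (WithLp.continuous_snd ..).comp Φ.continuous
  have hcont2 : Continuous fun y => g (Φ y).fst := by
    exact hg.continuous.comp ((WithLp.continuous_fst ..).comp Φ.continuous)
  have hnot : x ∉ Ω := by
    rw [frontier, hΩ.isOpen.interior_eq] at hxf
    exact hxf.2
  have hle : (Φ x).snd ≤ g (Φ x).fst := by
    by_contra! h
    exact hnot ((hx x hxb).2 h)
  have hge : g (Φ x).fst ≤ (Φ x).snd := by
    by_contra! h
    have hev : ∀ᶠ y in nhds x, y ∉ Ω := by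
      filter_upwards [Metric.isOpen_ball.mem_nhds hxb,
        (isOpen_lt hcont1 hcont2).mem_nhds h] with y hy1 hy2 hy3
      exact lt_asymm hy2 ((hx y hy1).1 hy3)
    have := mem_closure_iff_frequently.1 hxf.1
    exact this hev
  refine ⟨(Φ x).fst, ?_, ?_⟩
  · rw [mem_ball_zero_iff]
    have h1 : ‖(Φ x).fst‖ ≤ ‖Φ x‖ := WithLp.norm_fst_le ..  
    rw [Φ.norm_map] at h1
    have h2 : ‖x‖ ≤ ‖p‖ + ‖x - p‖ := by
      simpa using norm_add_le p (x - p)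
    rw [mem_ball_iff_norm] at hxb
    linarith
  · have : WithLp.toLp 2 (G (Φ x).fst) = Φ x := by
      simp only [G, le_antisymm hge hle]
      rfl
    simp [this]

theorem IsBoundedLipschitzDomain.isCompact_frontier {Ω : Set E3}
    (hΩ : IsBoundedLipschitzDomain Ω) : IsCompact (frontier Ω) :=
  hΩ.isBounded.isCompact_closure.of_isClosed_subset isClosed_frontier frontier_subset_closure

theorem IsBoundedLipschitzDomain.isFiniteMeasure_surfaceMeasure {Ω : Set E3}
    (hΩ : IsBoundedLipschitzDomain Ω) : IsFiniteMeasure (surfaceMeasure Ω) := by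
  refine ⟨?_⟩
  rw [surfaceMeasure, Measure.restrict_apply_univ]
  refine hΩ.isCompact_frontier.measure_lt_top_of_nhdsWithin fun p hp => ?_
  obtain ⟨r, hr, f, C, R, hf, hsub⟩ := hΩ.exists_frontier_inter_ball_subset hp
  refine ⟨frontier Ω ∩ Metric.ball p r,
    inter_mem_nhdsWithin _ (Metric.ball_mem_nhds p hr), ?_⟩
  have h1 : Measure.hausdorffMeasure (2 : ℕ) (Metric.ball (0 : EuclideanSpace ℝ (Fin 2)) R) < ⊤ := by
    have : (Measure.hausdorffMeasure ((2 : ℕ) : ℝ) :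
        Measure (EuclideanSpace ℝ (Fin 2))).IsAddHaarMeasure := by
      simpa using isAddHaarMeasure_hausdorffMeasure (E := EuclideanSpace ℝ (Fin 2))
    exact measure_ball_lt_top
  have h2 : Measure.hausdorffMeasure (2 : ℕ) (frontier Ω ∩ Metric.ball p r) < ⊤ := by
    refine ((measure_mono hsub).trans (hf.hausdorffMeasure_image_le (by positivity) _)).trans_lt ?_
    exact ENNReal.mul_lt_top (ENNReal.rpow_lt_top_of_nonneg (by positivity) ENNReal.coe_ne_top) h1
  rw [Measure.euclideanHausdorffMeasure_def, Measure.smul_apply, ENNReal.smul_def]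
  exact ENNReal.mul_lt_top ENNReal.coe_lt_top h2

/-! ### Taylor approximation and size of the kernel. -/

/-- Cauchy's estimate for the remainder of a Taylor polynomial. -/
theorem exists_taylor_approx {f : ℂ → ℂ} {c : ℂ} {R M : ℝ} (hR : 0 < R)
    (hf : DifferentiableOn ℂ f (Metric.closedBall c R))
    (hM : ∀ z ∈ Metric.closedBall c R, ‖f z‖ ≤ M) (L : ℕ) :
    ∃ a : ℕ → ℂ, ∀ z : ℂ, ‖z - c‖ ≤ R / 2 →
      ‖f z - ∑ n ∈ Finset.range L, a n * (z - c) ^ n‖ ≤ 2 * M * (1 / 2) ^ L := by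
  refine ⟨fun n => ((n.factorial : ℂ))⁻¹ * iteratedDeriv n f c, fun z hz => ?_⟩
  have hd : DiffContOnCl ℂ f (Metric.ball c R) := hf.diffContOnCl_ball subset_rfl
  have hco : ∀ n, ‖iteratedDeriv n f c‖ ≤ n.factorial * M / R ^ n := fun n =>
    Complex.norm_iteratedDeriv_le_of_forall_mem_sphere_norm_le n hR hd
      fun w hw => hM w (Metric.sphere_subset_closedBall hw)
  have hs := Complex.hasSum_taylorSeries_on_ball (hf.mono Metric.ball_subset_closedBall)
    (z := z) (by rw [mem_ball_iff_norm]; linarith)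
  have hM0 : 0 ≤ M := (norm_nonneg _).trans (hM c (Metric.mem_closedBall_self hR.le))
  have hb : ∀ n, ‖((n.factorial : ℂ))⁻¹ • (z - c) ^ n • iteratedDeriv n f c‖ ≤ M * (1 / 2) ^ n := by
    intro n
    rw [norm_smul, norm_smul, norm_inv, norm_pow, Complex.norm_natCast]
    have h1 : ‖z - c‖ ^ n ≤ (R / 2) ^ n := by gcongr
    have h2 : (0 : ℝ) < n.factorial := by positivity
    calc ((n.factorial : ℝ))⁻¹ * (‖z - c‖ ^ n * ‖iteratedDeriv n f c‖)
        ≤ ((n.factorial : ℝ))⁻¹ * ((R / 2) ^ n * (n.factorial * M / R ^ n)) := by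
          gcongr
          exact hco n
      _ = M * (1 / 2) ^ n := by
          rw [div_pow, div_pow]
          field_simp
          simp
  have := norm_sub_le_of_geometric_bound_of_hasSum (by norm_num) hb hs L
  rw [norm_sub_rev] at this
  convert this using 1
  · congr 2
    refine Finset.sum_congr rfl fun n _ => ?_
    simp only [smul_eq_mul]
    ring
  · ring

/-- The function `r ↦ exp (i k r) / r` is approximated by polynomials in `r²`. -/
theorem exists_kernel_approx (k : ℂ) {r₀ : ℝ} (hr₀ : 0 < r₀) (L : ℕ) :
    ∃ a : ℕ → ℂ, ∀ r : ℝ, 0 ≤ r → |r ^ 2 - r₀ ^ 2| ≤ r₀ ^ 2 / 4 →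
      ‖Complex.exp (Complex.I * k * (r : ℂ)) / (r : ℂ) -
        ∑ n ∈ Finset.range L, a n * ((r ^ 2 - r₀ ^ 2 : ℝ) : ℂ) ^ n‖ ≤
        4 / r₀ * Real.exp (2 * r₀ * ‖k‖) * (1 / 2) ^ L := by
  -- The disc stays in the half plane `Re z ≥ r₀² / 2`, so the principal root is holomorphic there
  -- with modulus between `r₀ / 2` and `2 r₀`; this determines the bound `M` below.
  have hslit : ∀ z ∈ Metric.closedBall ((r₀ ^ 2 : ℝ) : ℂ) (r₀ ^ 2 / 2),
      z ∈ Complex.slitPlane ∧ r₀ / 2 ≤ ‖z ^ (1 / 2 : ℂ)‖ ∧ ‖z ^ (1 / 2 : ℂ)‖ ≤ 2 * r₀ := by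
    intro z hz
    rw [mem_closedBall_iff_norm] at hz
    have hsq : 0 < r₀ ^ 2 := by positivity
    have hre : r₀ ^ 2 / 2 ≤ z.re := by
      have h1 := (abs_le.1 ((Complex.abs_re_le_norm _).trans hz)).1
      rw [Complex.sub_re, Complex.ofReal_re] at h1
      linarith
    have hz1 : r₀ ^ 2 / 2 ≤ ‖z‖ := hre.trans (Complex.re_le_norm z)
    have hz2 : ‖z‖ ≤ 3 / 2 * r₀ ^ 2 := by
      have h1 := norm_add_le (z - ((r₀ ^ 2 : ℝ) : ℂ)) ((r₀ ^ 2 : ℝ) : ℂ)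
      rw [sub_add_cancel, Complex.norm_real, Real.norm_of_nonneg hsq.le] at h1
      linarith
    have hn : ‖z ^ (1 / 2 : ℂ)‖ ^ 2 = ‖z‖ := by
      rw [← norm_pow, ← Complex.cpow_nat_mul]
      norm_num
    refine ⟨Or.inl (by linarith), ?_, ?_⟩
    · nlinarith [norm_nonneg (z ^ (1 / 2 : ℂ))]
    · nlinarith [norm_nonneg (z ^ (1 / 2 : ℂ))]
  obtain ⟨a, ha⟩ := exists_taylor_approx
    (f := fun z : ℂ => Complex.exp (Complex.I * k * z ^ (1 / 2 : ℂ)) / z ^ (1 / 2 : ℂ))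
    (c := ((r₀ ^ 2 : ℝ) : ℂ)) (R := r₀ ^ 2 / 2) (M := 2 / r₀ * Real.exp (2 * r₀ * ‖k‖))
    (by positivity) (by
      intro z hz
      obtain ⟨h1, h2, h3⟩ := hslit z hz
      have hne : z ^ (1 / 2 : ℂ) ≠ 0 := by
        rw [← norm_pos_iff]
        linarith
      have hd : DifferentiableAt ℂ (fun z : ℂ => z ^ (1 / 2 : ℂ)) z :=
        differentiableAt_id.cpow_const h1
      exact (((hd.const_mul (Complex.I * k)).cexp).div hd hne).differentiableWithinAt) (by
      intro z hz
      obtain ⟨h1, h2, h3⟩ := hslit z hz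
      rw [norm_div, Complex.norm_exp]
      have h4 : (Complex.I * k * z ^ (1 / 2 : ℂ)).re ≤ 2 * r₀ * ‖k‖ := by
        refine (Complex.re_le_norm _).trans ?_
        rw [norm_mul, norm_mul, Complex.norm_I, one_mul, mul_comm]
        gcongr
      calc Real.exp (Complex.I * k * z ^ (1 / 2 : ℂ)).re / ‖z ^ (1 / 2 : ℂ)‖
          ≤ Real.exp (2 * r₀ * ‖k‖) / (r₀ / 2) := by gcongr
        _ = _ := by field_simp) L
  refine ⟨a, fun r hr h => ?_⟩
  have h1 := ha ((r ^ 2 : ℝ) : ℂ) (by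
    rw [← Complex.ofReal_sub, Complex.norm_real, Real.norm_eq_abs]
    linarith)
  have h2 : ((r ^ 2 : ℝ) : ℂ) ^ (1 / 2 : ℂ) = (r : ℂ) := by
    have : (1 / 2 : ℂ) = ((1 / 2 : ℝ) : ℂ) := by norm_num
    rw [this, ← Complex.ofReal_cpow (by positivity), ← Real.sqrt_eq_rpow, Real.sqrt_sq hr]
  simp only [h2, ← Complex.ofReal_sub] at h1
  refine h1.trans (le_of_eq ?_)
  ring

theorem norm_kernel_le {k : ℂ} (hk : 0 ≤ k.im) {ε r : ℝ} (hε : 0 < ε) (hr : ε ≤ r) :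
    ‖Complex.exp (Complex.I * k * (r : ℂ)) / (r : ℂ)‖ ≤ Real.exp (-(ε * k.im)) / ε := by
  have hr0 : 0 < r := hε.trans_le hr
  rw [norm_div, Complex.norm_exp, Complex.norm_real, Real.norm_of_nonneg hr0.le]
  have : (Complex.I * k * (r : ℂ)).re = -(r * k.im) := by
    simp [mul_comm]
  rw [this]
  gcongr

/-! ### Attenuation against growth in frequency. -/

/-- Already one term of the exponential series, of order `n = ⌈2 / β⌉`, dominates `(1 + |ω|)²`. -/
theorem exp_neg_rpow_le {b β : ℝ} (hb : 0 < b) (hβ : 0 < β) :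
    ∃ K : ℝ, 0 < K ∧ ∀ ω : ℝ, Real.exp (-(b * (1 + |ω|) ^ β)) ≤ K * (1 + ω ^ 2)⁻¹ := by
  set n := ⌈2 / β⌉₊ with hn
  refine ⟨n.factorial / b ^ n, by positivity, fun ω => ?_⟩
  have hx : 1 ≤ 1 + |ω| := by linarith [abs_nonneg ω]
  set x := 1 + |ω| with hxdef
  have h1 : 1 + ω ^ 2 ≤ x ^ 2 := by
    rw [hxdef]
    nlinarith [abs_nonneg ω, sq_abs ω]
  have h2 : x ^ 2 ≤ (x ^ β) ^ n := by
    rw [← Real.rpow_natCast x 2, ← Real.rpow_natCast (x ^ β) n, ← Real.rpow_mul (by linarith)]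
    refine Real.rpow_le_rpow_of_exponent_le hx ?_
    have := Nat.le_ceil (2 / β)
    rw [div_le_iff₀ hβ] at this
    push_cast
    linarith
  have h3 := Real.pow_div_factorial_le_exp (b * x ^ β) (by positivity) n
  have h4 : 0 < 1 + ω ^ 2 := by positivity
  rw [Real.exp_neg, ← div_eq_mul_inv, inv_eq_one_div, div_le_div_iff₀ (Real.exp_pos _) h4, one_mul]
  calc 1 + ω ^ 2 ≤ (x ^ β) ^ n := h1.trans h2
    _ = n.factorial / b ^ n * ((b * x ^ β) ^ n / n.factorial) := by
        rw [mul_pow]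
        field_simp
    _ ≤ _ := by gcongr

section Attenuation

variable {κ : ℝ → ℂ} {β : ℝ}

/-- For `|ω| ≥ max 1 ω₀` one has `1 + |ω| ≤ 2 |ω|`, whence the factor `2 ^ β`; smaller frequencies
are absorbed in `K`, using `Im κ ≥ 0`. -/
theorem IsStrongAttenuationCoefficient.exp_neg_im_le (hκ : IsStrongAttenuationCoefficient κ β)
    {ε : ℝ} (hε : 0 < ε) :
    ∃ b : ℝ, 0 < b ∧ ∃ K : ℝ, 0 < K ∧ ∀ ω : ℝ,
      Real.exp (-(ε * (κ ω).im)) ≤ K * Real.exp (-(b * (1 + |ω|) ^ β)) := by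
  obtain ⟨κ₀, hκ₀, ω₀, hω₀, h⟩ := hκ.strong
  have hβ := hκ.exponent_pos
  set b := ε * κ₀ / 2 ^ β with hb
  have hb0 : 0 < b := by positivity
  set m := max 1 ω₀ with hm
  refine ⟨b, hb0, Real.exp (b * (1 + m) ^ β), Real.exp_pos _, fun ω => ?_⟩
  rw [← Real.exp_add, Real.exp_le_exp]
  have hm0 : 1 ≤ m := le_max_left _ _
  have hab := abs_nonneg ω
  rcases le_total m |ω| with hc | hc
  · have h1 : (1 + |ω|) ^ β ≤ 2 ^ β * |ω| ^ β := by
      rw [← Real.mul_rpow (by norm_num) hab]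
      exact Real.rpow_le_rpow (by positivity) (by linarith) hβ.le
    have h2 := h ω ((le_max_right _ _).trans hc)
    have h3 : b * (1 + |ω|) ^ β ≤ ε * (κ ω).im := by
      calc b * (1 + |ω|) ^ β ≤ b * (2 ^ β * |ω| ^ β) := by gcongr
        _ = ε * (κ₀ * |ω| ^ β) := by
            rw [hb]
            field_simp
        _ ≤ _ := by gcongr
    have h4 : 0 ≤ b * (1 + m) ^ β := by positivity
    linarith
  · have h1 : b * (1 + |ω|) ^ β ≤ b * (1 + m) ^ β := by gcongr
    have h2 : 0 ≤ ε * (κ ω).im := mul_nonneg hε.le (hκ.im_nonneg ω)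
    linarith

/-- The lower bound on `Im κ` would outgrow the upper bound on `|κ|` otherwise. The consequences `N
> 0` and `β / N ≤ 1` are used throughout. -/
theorem IsStrongAttenuationCoefficient.exponent_le (hκ : IsStrongAttenuationCoefficient κ β)
    {N : ℕ} (hN : HasGrowthExponent κ N) : β ≤ N := by
  obtain ⟨κ₀, hκ₀, ω₀, hω₀, h⟩ := hκ.strong
  obtain ⟨κ₁, hκ₁, h'⟩ := hN
  by_contra! hlt
  have ht := tendsto_rpow_atTop (sub_pos.2 hlt)
  obtain ⟨x, hx1, hx2, hx3⟩ := ((ht.eventually_gt_atTop (κ₁ * 2 ^ N / κ₀)).and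
    ((Filter.eventually_ge_atTop 1).and (Filter.eventually_ge_atTop ω₀))).exists
  have hx0 : 0 < x := by linarith
  have habs : |x| = x := abs_of_pos hx0
  have h1 := (h x (by rwa [habs])).trans ((Complex.im_le_norm _).trans (h' x))
  rw [habs] at h1
  have h2 : (1 + x) ^ N ≤ 2 ^ N * x ^ N := by
    rw [← mul_pow]
    exact pow_le_pow_left₀ (by positivity) (by linarith) N
  rw [Real.rpow_sub hx0, Real.rpow_natCast, div_lt_div_iff₀ hκ₀ (by positivity)] at hx1
  have h3 : κ₁ * (1 + x) ^ N ≤ κ₁ * (2 ^ N * x ^ N) := by gcongr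
  linarith

/-- At each frequency, either the kernel is so regular that polynomials of degree less than `L`
approximate it well, or it is small. -/
theorem IsStrongAttenuationCoefficient.dichotomy (hκ : IsStrongAttenuationCoefficient κ β)
    {N : ℕ} (hN : HasGrowthExponent κ N) {ε D : ℝ} (hε : 0 < ε) (hD : 0 < D) :
    ∃ K : ℝ, 0 < K ∧ ∃ c : ℝ, 0 < c ∧ ∀ (L : ℕ) (ω : ℝ),
      (Real.exp (2 * D * ‖κ ω‖) * (1 / 2) ^ L ≤
        K * Real.exp (-(c * (L : ℝ) ^ (β / N))) * (1 + ω ^ 2)⁻¹) ∨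
      (Real.exp (-(ε * (κ ω).im)) ≤
        K * Real.exp (-(c * (L : ℝ) ^ (β / N))) * (1 + ω ^ 2)⁻¹) := by
  have hβ := hκ.exponent_pos
  have hβN := hκ.exponent_le hN
  have hN0 : (0 : ℝ) < N := hβ.trans_le hβN
  have hN1 : N ≠ 0 := by
    rintro rfl
    simp at hN0
  have hp0 : 0 < β / N := by positivity
  have hp1 : β / N ≤ 1 := (div_le_one hN0).2 hβN
  obtain ⟨b, hb, K₁, hK₁, hexp⟩ := hκ.exp_neg_im_le hε
  obtain ⟨K₂, hK₂, hexp'⟩ := exp_neg_rpow_le (half_pos hb) hβ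
  obtain ⟨κ₁, hκ₁, hgr⟩ := hN
  have hlog : 0 < Real.log 2 := Real.log_pos (by norm_num)
  -- With these constants `2^(-L) = exp (-4ηL)`, while `(1 + |ω|)^N ≤ γ L` forces `2D|κ(ω)| ≤ 2ηL`.
  -- Of the remaining `exp (-2ηL)`, one half is the decay and the other pays for `1 + ω² ≤ γ² L²`.
  set η := Real.log 2 / 4 with hη
  have hη0 : 0 < η := by positivity
  set γ := η / (D * κ₁) with hγ
  have hγ0 : 0 < γ := by positivity
  set c := min η (b / 2 * γ ^ (β / N)) with hc
  have hc0 : 0 < c := lt_min hη0 (by positivity)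
  set K := max (γ ^ 2 * (2 / η ^ 2)) (K₁ * K₂) with hK
  refine ⟨K, lt_max_of_lt_right (by positivity), c, hc0, fun L ω => ?_⟩
  have hx : 1 ≤ 1 + |ω| := by linarith [abs_nonneg ω]
  set x := 1 + |ω| with hxdef
  have hω : 1 + ω ^ 2 ≤ x ^ 2 := by
    rw [hxdef]
    nlinarith [abs_nonneg ω, sq_abs ω]
  rcases le_or_gt (x ^ N) (γ * L) with h | h
  · left
    rw [← div_eq_mul_inv, le_div_iff₀ (by positivity)]
    have hL : (L : ℝ) ^ (β / N) ≤ L := by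
      rcases Nat.eq_zero_or_pos L with h0 | h0
      · simp [h0, Real.zero_rpow hp0.ne']
      · exact (Real.rpow_le_rpow_of_exponent_le (by exact_mod_cast h0) hp1).trans
          (Real.rpow_one _).le
    have h1 : Real.exp (2 * D * ‖κ ω‖) * (1 / 2) ^ L ≤ Real.exp (-(η * L)) * Real.exp (-(η * L)) := by
      have h2 : ((1 : ℝ) / 2) ^ L = Real.exp (-(4 * η * L)) := by
        rw [one_div, inv_pow, Real.exp_neg, hη]
        congr 1
        rw [show 4 * (Real.log 2 / 4) * (L : ℝ) = (L : ℝ) * Real.log 2 by ring, Real.exp_nat_mul,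
          Real.exp_log (by norm_num)]
      rw [h2, ← Real.exp_add, ← Real.exp_add, Real.exp_le_exp]
      have h3 : 2 * D * ‖κ ω‖ ≤ 2 * η * L := by
        calc 2 * D * ‖κ ω‖ ≤ 2 * D * (κ₁ * (γ * L)) := by
              gcongr
              exact (hgr ω).trans (by gcongr)
          _ = 2 * η * L := by
              rw [hγ]
              field_simp
      linarith
    have h4 : 1 + ω ^ 2 ≤ γ ^ 2 * (L : ℝ) ^ 2 := by
      refine hω.trans ?_
      rw [← mul_pow]
      refine pow_le_pow_left₀ (by positivity) (le_trans ?_ h) 2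
      exact le_self_pow₀ hx hN1
    have h5 : (L : ℝ) ^ 2 * Real.exp (-(η * L)) ≤ 2 / η ^ 2 := by
      have := Real.pow_div_factorial_le_exp (η * L) (by positivity) 2
      rw [Real.exp_neg, ← div_eq_mul_inv, div_le_div_iff₀ (Real.exp_pos _) (by positivity)]
      rw [div_le_iff₀ (by positivity), mul_pow] at this
      norm_num at this
      linarith
    calc Real.exp (2 * D * ‖κ ω‖) * (1 / 2) ^ L * (1 + ω ^ 2)
        ≤ (Real.exp (-(η * L)) * Real.exp (-(η * L))) * (γ ^ 2 * (L : ℝ) ^ 2) := by gcongr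
      _ = γ ^ 2 * ((L : ℝ) ^ 2 * Real.exp (-(η * L))) * Real.exp (-(η * L)) := by ring
      _ ≤ γ ^ 2 * (2 / η ^ 2) * Real.exp (-(η * L)) := by gcongr
      _ ≤ K * Real.exp (-(c * (L : ℝ) ^ (β / N))) := by
          gcongr
          · exact le_max_left _ _
          · exact min_le_left _ _
  · right
    -- Raising `γ L < x ^ N` to the power `β / N` turns frequency decay into decay in `L`; half of
    -- the exponent is kept for the weight.
    have h1 : γ ^ (β / N) * (L : ℝ) ^ (β / N) ≤ x ^ β := by
      rw [← Real.mul_rpow hγ0.le (by positivity)]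
      calc (γ * L) ^ (β / N) ≤ (x ^ N) ^ (β / N) := by gcongr
        _ = x ^ β := by
            rw [← Real.rpow_natCast, ← Real.rpow_mul (by linarith)]
            congr 1
            field_simp
    calc Real.exp (-(ε * (κ ω).im)) ≤ K₁ * Real.exp (-(b * x ^ β)) := hexp ω
      _ = K₁ * (Real.exp (-(b / 2 * x ^ β)) * Real.exp (-(b / 2 * x ^ β))) := by
          rw [← Real.exp_add]
          congr 2
          ring
      _ ≤ K₁ * (Real.exp (-(c * (L : ℝ) ^ (β / N))) * (K₂ * (1 + ω ^ 2)⁻¹)) := by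
          refine mul_le_mul_of_nonneg_left (mul_le_mul (Real.exp_le_exp.2 (neg_le_neg ?_)) (hexp' ω)
            (Real.exp_pos _).le (Real.exp_pos _).le) hK₁.le
          · calc c * (L : ℝ) ^ (β / N) ≤ b / 2 * γ ^ (β / N) * (L : ℝ) ^ (β / N) := by
                  gcongr
                  exact min_le_right _ _
              _ = b / 2 * (γ ^ (β / N) * (L : ℝ) ^ (β / N)) := by ring
              _ ≤ _ := by gcongr
      _ = K₁ * K₂ * Real.exp (-(c * (L : ℝ) ^ (β / N))) * (1 + ω ^ 2)⁻¹ := by ring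
      _ ≤ _ := by
          gcongr
          exact le_max_right _ _

end Attenuation

/-! ### Cells and piecewise polynomials. -/

/-- A totally bounded set is partitioned measurably into finitely many cells close to a centre. -/
theorem exists_simpleFunc_dist_le {S : Set E3} (hS : TotallyBounded S) {δ : ℝ} (hδ : 0 < δ) :
    ∃ c : SimpleFunc E3 E3, ∀ y ∈ S, c y ∈ S ∧ dist (c y) y ≤ δ := by
  obtain ⟨t, htS, hfin, hcov⟩ := Metric.finite_approx_of_totallyBounded hS δ hδ
  rcases t.eq_empty_or_nonempty with rfl | hne
  · refine ⟨SimpleFunc.const _ 0, fun y hy => ?_⟩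
    simpa using hcov hy
  · obtain ⟨e, he⟩ := hfin.countable.exists_eq_range hne
    have hidx : ∀ x ∈ t, ∃ k, e k = x := fun x hx => by rwa [he] at hx
    choose! idx hidx using hidx
    refine ⟨SimpleFunc.nearestPt e (hfin.toFinset.sup idx), fun y hy => ⟨htS ?_, ?_⟩⟩
    · have hmem : ∀ k, e k ∈ t := fun k => by
        rw [he]
        exact ⟨k, rfl⟩
      exact hmem _
    · obtain ⟨x, hx, hyx⟩ := Set.mem_iUnion₂.1 (hcov hy)
      have h1 := SimpleFunc.edist_nearestPt_le e y
        (Finset.le_sup (f := idx) (hfin.mem_toFinset.2 hx))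
      rw [hidx x hx, edist_dist, edist_dist, ENNReal.ofReal_le_ofReal_iff dist_nonneg] at h1
      rw [Metric.mem_ball, dist_comm] at hyx
      exact h1.trans hyx.le

/-- A monomial of exponent `α`, cut off to the cell on which `c = p`. -/
def cellMonomial (c : SimpleFunc E3 E3) (p : E3) (α : Fin 3 → ℕ) (y : E3) : ℂ :=
  open Classical in if c y = p then ∏ i, ((y i : ℝ) : ℂ) ^ α i else 0

theorem measurable_cellMonomial (c : SimpleFunc E3 E3) (p : E3) (α : Fin 3 → ℕ) :
    Measurable (cellMonomial c p α) := by
  refine Measurable.ite (c.measurableSet_preimage {p}) ?_ measurable_const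
  fun_prop

/-- The functions which are polynomials of degree less than `m` in each variable on each cell. -/
def cellPolynomials (c : SimpleFunc E3 E3) (m : ℕ) : Submodule ℂ (E3 → ℂ) :=
  Submodule.span ℂ (Set.range fun j : c.range × (Fin 3 → Fin m) =>
    cellMonomial c j.1 fun i => j.2 i)

theorem eval_mem_cellPolynomials (c : SimpleFunc E3 E3) {p : E3} (hp : p ∈ c.range) {m : ℕ}
    {Q : MvPolynomial (Fin 3) ℂ} (hQ : Q.totalDegree < m) :
    (fun y => open Classical in if c y = p then MvPolynomial.eval (fun i => ((y i : ℝ) : ℂ)) Q else 0)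
      ∈ cellPolynomials c m := by
  classical
  have : (fun y => if c y = p then MvPolynomial.eval (fun i => ((y i : ℝ) : ℂ)) Q else 0) =
      ∑ d ∈ Q.support, Q.coeff d • cellMonomial c p d := by
    funext y
    rw [Finset.sum_apply]
    by_cases h : c y = p
    · simp [h, cellMonomial, MvPolynomial.eval_eq']
    · simp [h, cellMonomial]
  rw [this]
  refine Submodule.sum_mem _ fun d hd => Submodule.smul_mem _ _ (Submodule.subset_span ?_)
  have hdm : ∀ i, d i < m := fun i =>
    ((MvPolynomial.degreeOf_le_iff.1 (MvPolynomial.degreeOf_le_totalDegree Q i)) d hd).trans_lt hQ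
  exact ⟨(⟨p, hp⟩, fun i => ⟨d i, hdm i⟩), rfl⟩

/-- On a cell `c y` is constant and the squared distance is quadratic in `y`, so powers below `L`
have degree below `2 L`. The space does not depend on `ξ` or on the coefficients `a`. -/
theorem sqDist_mem_cellPolynomials (c : SimpleFunc E3 E3) (ξ : E3) (L : ℕ) (a : E3 → ℕ → ℂ) :
    (fun y => ∑ n ∈ Finset.range L, a (c y) n *
      ((‖ξ - y‖ ^ 2 - ‖ξ - c y‖ ^ 2 : ℝ) : ℂ) ^ n) ∈ cellPolynomials c (2 * L) := by
  classical
  let q : E3 → MvPolynomial (Fin 3) ℂ := fun p =>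
    (∑ i, (MvPolynomial.C ((ξ i : ℝ) : ℂ) - MvPolynomial.X i) ^ 2) -
      MvPolynomial.C ((‖ξ - p‖ ^ 2 : ℝ) : ℂ)
  have hdeg : ∀ p, (q p).totalDegree ≤ 2 := by
    intro p
    refine (MvPolynomial.totalDegree_sub _ _).trans (max_le ?_ ?_)
    swap
    · rw [MvPolynomial.totalDegree_C]
      norm_num
    refine MvPolynomial.totalDegree_finsetSum_le fun i _ => ?_
    refine (MvPolynomial.totalDegree_pow _ _).trans ?_
    have : (MvPolynomial.C ((ξ i : ℝ) : ℂ) - MvPolynomial.X i).totalDegree ≤ 1 :=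
      (MvPolynomial.totalDegree_sub _ _).trans (by simp)
    omega
  have heval : ∀ p y, MvPolynomial.eval (fun i => ((y i : ℝ) : ℂ)) (q p) =
      ((‖ξ - y‖ ^ 2 - ‖ξ - p‖ ^ 2 : ℝ) : ℂ) := by
    intro p y
    simp only [q, map_sub, map_sum, map_pow, MvPolynomial.eval_C, MvPolynomial.eval_X]
    rw [EuclideanSpace.norm_sq_eq (ξ - y)]
    simp
  have : (fun y => ∑ n ∈ Finset.range L, a (c y) n *
      ((‖ξ - y‖ ^ 2 - ‖ξ - c y‖ ^ 2 : ℝ) : ℂ) ^ n) =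
      ∑ p ∈ c.range, ∑ n ∈ Finset.range L, a p n • fun y =>
        if c y = p then MvPolynomial.eval (fun i => ((y i : ℝ) : ℂ)) (q p ^ n) else 0 := by
    funext y
    rw [Finset.sum_apply, Finset.sum_eq_single (c y)]
    · simp only [Finset.sum_apply, Pi.smul_apply, smul_eq_mul, if_true, map_pow, heval]
    · intro p _ hne
      simp [hne.symm]
    · intro h
      exact absurd (c.mem_range_self y) h
  rw [this]
  refine Submodule.sum_mem _ fun p hp => Submodule.sum_mem _ fun n hn => Submodule.smul_mem _ _ ?_
  refine eval_mem_cellPolynomials c hp ?_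
  have h1 := MvPolynomial.totalDegree_pow (q p) n
  have h2 := Nat.mul_le_mul_left n (hdeg p)
  rw [Finset.mem_range] at hn
  omega

/-! ### Integration against sources in `L²(Ω_ε)`. -/

section Source

variable {Ω : Set E3} {ε : ℝ}

theorem measurableSet_innerDomain (hΩ : IsBoundedLipschitzDomain Ω) :
    MeasurableSet (innerDomain Ω ε) :=
  hΩ.isOpen.measurableSet.inter
    (isOpen_lt continuous_const (Metric.continuous_infDist_pt _)).measurableSet

theorem isBounded_innerDomain (hΩ : IsBoundedLipschitzDomain Ω) :
    Bornology.IsBounded (innerDomain Ω ε) :=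
  hΩ.isBounded.subset fun _ h => h.1

theorem isFiniteMeasure_innerDomain (hΩ : IsBoundedLipschitzDomain Ω) :
    IsFiniteMeasure ((volume : Measure E3).restrict (innerDomain Ω ε)) :=
  ⟨by
    rw [Measure.restrict_apply_univ]
    exact (isBounded_innerDomain hΩ).measure_lt_top⟩

theorem lt_norm_sub_of_mem_innerDomain {y ξ : E3} (hy : y ∈ innerDomain Ω ε)
    (hξ : ξ ∈ frontier Ω) : ε < ‖ξ - y‖ := by
  have := hy.2.trans_le (Metric.infDist_le_dist_of_mem hξ)
  rwa [dist_comm, dist_eq_norm] at this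

theorem exists_norm_sub_le (hΩ : IsBoundedLipschitzDomain Ω) :
    ∃ D : ℝ, 0 < D ∧ ∀ y ∈ innerDomain Ω ε, ∀ ξ ∈ frontier Ω, ‖ξ - y‖ ≤ D := by
  obtain ⟨R, hR, hsub⟩ := hΩ.isBounded.closure.subset_ball_lt 0 0
  refine ⟨R + R, by positivity, fun y hy ξ hξ => (norm_sub_le _ _).trans (add_le_add ?_ ?_)⟩
  · exact (mem_ball_zero_iff.1 (hsub (frontier_subset_closure hξ))).le
  · exact (mem_ball_zero_iff.1 (hsub (subset_closure hy.1))).le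

theorem memLp_cellMonomial (hΩ : IsBoundedLipschitzDomain Ω) (c : SimpleFunc E3 E3) (p : E3)
    (α : Fin 3 → ℕ) :
    MemLp (cellMonomial c p α) 2 ((volume : Measure E3).restrict (innerDomain Ω ε)) := by
  have := isFiniteMeasure_innerDomain (ε := ε) hΩ
  obtain ⟨R, hR, hsub⟩ := (isBounded_innerDomain (ε := ε) hΩ).subset_ball_lt 0 0
  refine MemLp.of_bound (measurable_cellMonomial c p α).aestronglyMeasurable (∏ i, R ^ α i) ?_
  refine (ae_restrict_iff' (measurableSet_innerDomain hΩ)).2 (Filter.Eventually.of_forall ?_)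
  intro y hy
  unfold cellMonomial
  split_ifs
  · rw [norm_prod]
    refine Finset.prod_le_prod (fun _ _ => norm_nonneg _) fun i _ => ?_
    rw [norm_pow, Complex.norm_real]
    gcongr
    exact (PiLp.norm_apply_le y i).trans (mem_ball_zero_iff.1 (hsub hy)).le
  · rw [norm_zero]
    positivity

/-- The space of cell polynomials, as a subspace of `L²(Ω_ε)`. -/
def cellPolynomialSpace (hΩ : IsBoundedLipschitzDomain Ω) (ε : ℝ) (c : SimpleFunc E3 E3) (m : ℕ) :
    Submodule ℂ (SourceSpace Ω ε) :=
  Submodule.span ℂ (Set.range fun j : c.range × (Fin 3 → Fin m) =>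
    (memLp_cellMonomial (ε := ε) hΩ c j.1 fun i => j.2 i).toLp)

instance finiteDimensional_cellPolynomialSpace (hΩ : IsBoundedLipschitzDomain Ω) (c : SimpleFunc E3 E3) (m : ℕ) :
    FiniteDimensional ℂ (cellPolynomialSpace hΩ ε c m) :=
  FiniteDimensional.span_of_finite ℂ (Set.finite_range _)

theorem finrank_cellPolynomialSpace_le (hΩ : IsBoundedLipschitzDomain Ω) (c : SimpleFunc E3 E3)
    (m : ℕ) : Module.finrank ℂ (cellPolynomialSpace hΩ ε c m) ≤ c.range.card * m ^ 3 := by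
  refine (finrank_range_le_card _).trans (le_of_eq ?_)
  simp

/-- Cell polynomials integrate to zero against the functions orthogonal to them. -/
theorem integral_cellPolynomial_mul_eq_zero (hΩ : IsBoundedLipschitzDomain Ω)
    {c : SimpleFunc E3 E3} {m : ℕ} {h : SourceSpace Ω ε} (hh : h ∈ (cellPolynomialSpace hΩ ε c m)ᗮ)
    {T : E3 → ℂ} (hT : T ∈ cellPolynomials c m) :
    Integrable (fun y => T y * h y) (volume.restrict (innerDomain Ω ε)) ∧
      ∫ y in innerDomain Ω ε, T y * h y = 0 := by
  induction hT using Submodule.span_induction with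
  | mem T hT =>
    obtain ⟨j, rfl⟩ := hT
    have hmem := memLp_cellMonomial (ε := ε) hΩ c j.1 fun i => j.2 i
    refine ⟨hmem.integrable_mul (Lp.memLp h), ?_⟩
    have h0 : inner ℂ hmem.toLp h = 0 := hh _ (Submodule.subset_span ⟨j, rfl⟩)
    rw [L2.inner_def] at h0
    rw [← h0]
    refine integral_congr_ae ?_
    filter_upwards [hmem.coeFn_toLp] with y hy
    rw [hy, RCLike.inner_apply, mul_comm]
    congr 1
    -- The inner product conjugates its first argument, which is harmless: the monomials are
    -- real-valued.
    unfold cellMonomial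
    split_ifs <;> simp [map_pow]
  | zero => simp
  | add f g _ _ hf hg =>
    simp only [Pi.add_apply, add_mul]
    exact ⟨hf.1.add hg.1, by rw [integral_add hf.1 hg.1, hf.2, hg.2, add_zero]⟩
  | smul a f _ hf =>
    simp only [Pi.smul_apply, smul_eq_mul, mul_assoc]
    exact ⟨hf.1.const_mul a, by rw [integral_const_mul, hf.2, mul_zero]⟩

/-- Hölder's inequality on a set of finite measure; the `+ 1` only makes `A` positive. -/
theorem exists_integral_norm_le (hΩ : IsBoundedLipschitzDomain Ω) (ε : ℝ) :
    ∃ A : ℝ, 0 < A ∧ ∀ h : SourceSpace Ω ε, ∫ y in innerDomain Ω ε, ‖h y‖ ≤ A * ‖h‖ := by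
  have := isFiniteMeasure_innerDomain (ε := ε) hΩ
  set μ := (volume : Measure E3).restrict (innerDomain Ω ε) with hμ
  refine ⟨(μ Set.univ ^ (1 / (1 : ENNReal).toReal - 1 / (2 : ENNReal).toReal)).toReal + 1,
    by positivity, fun h => ?_⟩
  have hm : AEStronglyMeasurable h μ := Lp.aestronglyMeasurable h
  have h1 := eLpNorm_le_eLpNorm_mul_rpow_measure_univ (p := 1) (q := 2) (by norm_num) hm
  have hfin : μ Set.univ ^ (1 / (1 : ENNReal).toReal - 1 / (2 : ENNReal).toReal) ≠ ⊤ :=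
    ENNReal.rpow_ne_top_of_nonneg (by norm_num) (measure_ne_top μ _)
  have h2 := ENNReal.toReal_mono (ENNReal.mul_ne_top (Lp.eLpNorm_ne_top h) hfin) h1
  rw [ENNReal.toReal_mul, ← Lp.norm_def] at h2
  rw [integral_norm_eq_lintegral_enorm hm, ← eLpNorm_one_eq_lintegral_enorm]
  nlinarith [norm_nonneg h]

/-- If the kernel is uniformly close to a cell polynomial, the integral is small on the orthogonal
complement of the cell polynomials. -/
theorem norm_photoacousticIntegral_le (hΩ : IsBoundedLipschitzDomain Ω) {A : ℝ}
    (hA : ∀ h : SourceSpace Ω ε, ∫ y in innerDomain Ω ε, ‖h y‖ ≤ A * ‖h‖)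
    {κ : ℝ → ℂ} {ω : ℝ} {ξ : E3} {B : ℝ} (hB : 0 ≤ B) {h : SourceSpace Ω ε} {T : E3 → ℂ}
    (hT : Integrable (fun y => T y * h y) (volume.restrict (innerDomain Ω ε)) ∧
      ∫ y in innerDomain Ω ε, T y * h y = 0)
    (hint : Integrable (fun y => Complex.exp (Complex.I * κ ω * (‖ξ - y‖ : ℂ)) / (‖ξ - y‖ : ℂ) * h y)
      (volume.restrict (innerDomain Ω ε)))
    (hk : ∀ y ∈ innerDomain Ω ε,
      ‖Complex.exp (Complex.I * κ ω * (‖ξ - y‖ : ℂ)) / (‖ξ - y‖ : ℂ) - T y‖ ≤ B) :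
    ‖photoacousticIntegral κ Ω ε h ω ξ‖ ≤ B * (A * ‖h‖) := by
  have := isFiniteMeasure_innerDomain (ε := ε) hΩ
  have hh : Integrable h (volume.restrict (innerDomain Ω ε)) :=
    (Lp.memLp h).integrable (by norm_num)
  have hc : ‖((1 / (4 * Real.pi * Real.sqrt (2 * Real.pi)) : ℝ) : ℂ)‖ ≤ 1 := by
    rw [Complex.norm_real, Real.norm_of_nonneg (by positivity)]
    have h1 : 1 ≤ Real.sqrt (2 * Real.pi) := by
      rw [Real.one_le_sqrt]
      linarith [Real.pi_gt_three]
    have h2 : 1 ≤ 4 * Real.pi * Real.sqrt (2 * Real.pi) := by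
      nlinarith [Real.pi_gt_three]
    exact (div_le_one (by positivity)).2 h2
  unfold photoacousticIntegral
  rw [norm_mul]
  refine (mul_le_of_le_one_left (norm_nonneg _) hc).trans ?_
  -- Subtracting `∫ T h = 0` replaces the kernel by its distance to `T`.
  rw [← sub_zero (integral _ _), ← hT.2, ← integral_sub hint hT.1]
  calc _ ≤ ∫ y in innerDomain Ω ε, B * ‖h y‖ := by
        refine norm_integral_le_of_norm_le (hh.norm.const_mul B) ?_
        refine (ae_restrict_iff' (measurableSet_innerDomain hΩ)).2 (Filter.Eventually.of_forall ?_)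
        intro y hy
        rw [← sub_mul, norm_mul]
        exact mul_le_mul_of_nonneg_right (hk y hy) (norm_nonneg _)
    _ = B * ∫ y in innerDomain Ω ε, ‖h y‖ := integral_const_mul _ _
    _ ≤ _ := by
        gcongr
        exact hA h

end Source

/-! ### The operator and its decay off the test spaces. -/

section Operator

variable {Ω : Set E3} {ε : ℝ} {κ : ℝ → ℂ} {β : ℝ}

/-- The frequency weight `1 / (1 + ω²)` on `ℝ × ∂Ω`. -/
def frequencyWeight (q : ℝ × E3) : ℝ := (1 + q.1 ^ 2)⁻¹

/-- The weight is at most one and integrable in `ω`, and the surface measure is finite. -/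
theorem memLp_frequencyWeight (hΩ : IsBoundedLipschitzDomain Ω) :
    MemLp frequencyWeight 2 ((volume : Measure ℝ).prod (surfaceMeasure Ω)) := by
  have := hΩ.isFiniteMeasure_surfaceMeasure
  have hint : Integrable frequencyWeight ((volume : Measure ℝ).prod (surfaceMeasure Ω)) :=
    integrable_inv_one_add_sq.comp_fst (surfaceMeasure Ω)
  have hm : Measurable frequencyWeight := by
    unfold frequencyWeight
    fun_prop
  rw [memLp_two_iff_integrable_sq hm.aestronglyMeasurable]
  refine hint.mono (hm.pow_const 2).aestronglyMeasurable (Filter.Eventually.of_forall fun q => ?_)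
  have h0 : 0 ≤ frequencyWeight q := by
    unfold frequencyWeight
    positivity
  have h1 : frequencyWeight q ≤ 1 := inv_le_one_of_one_le₀ (by nlinarith [sq_nonneg q.1])
  rw [Real.norm_of_nonneg (by positivity), Real.norm_of_nonneg h0]
  nlinarith

theorem integrable_kernel_mul (hΩ : IsBoundedLipschitzDomain Ω) (hε : 0 < ε) {k : ℂ}
    (hk : 0 ≤ k.im) {ξ : E3} (hξ : ξ ∈ frontier Ω) (h : SourceSpace Ω ε) :
    Integrable (fun y => Complex.exp (Complex.I * k * (‖ξ - y‖ : ℂ)) / (‖ξ - y‖ : ℂ) * h y)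
      (volume.restrict (innerDomain Ω ε)) := by
  have := isFiniteMeasure_innerDomain (ε := ε) hΩ
  have hh : Integrable h (volume.restrict (innerDomain Ω ε)) :=
    (Lp.memLp h).integrable (by norm_num)
  refine hh.bdd_mul (c := Real.exp (-(ε * k.im)) / ε) ?_ ?_
  · have : Measurable fun y : E3 =>
        Complex.exp (Complex.I * k * (‖ξ - y‖ : ℂ)) / (‖ξ - y‖ : ℂ) := by fun_prop
    exact this.aestronglyMeasurable
  · refine (ae_restrict_iff' (measurableSet_innerDomain hΩ)).2 (Filter.Eventually.of_forall ?_)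
    intro y hy
    exact norm_kernel_le hk hε (lt_norm_sub_of_mem_innerDomain hy hξ).le

theorem stronglyMeasurable_photoacousticIntegral (hΩ : IsBoundedLipschitzDomain Ω)
    (hκ : Continuous κ) (h : SourceSpace Ω ε) :
    StronglyMeasurable fun q : ℝ × E3 => photoacousticIntegral κ Ω ε h q.1 q.2 := by
  have := isFiniteMeasure_innerDomain (ε := ε) hΩ
  have hh : Measurable h := (Lp.stronglyMeasurable h).measurable
  have hκm := hκ.measurable
  unfold photoacousticIntegral
  refine StronglyMeasurable.const_mul (StronglyMeasurable.integral_prod_right ?_) _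
  refine Measurable.stronglyMeasurable ?_
  unfold Function.uncurry
  fun_prop

theorem ae_snd_mem_frontier (hΩ : IsBoundedLipschitzDomain Ω) :
    ∀ᵐ q ∂((volume : Measure ℝ).prod (surfaceMeasure Ω)), q.2 ∈ frontier Ω := by
  have := hΩ.isFiniteMeasure_surfaceMeasure
  refine Measure.quasiMeasurePreserving_snd.ae (p := fun ξ => ξ ∈ frontier Ω) ?_
  exact ae_restrict_mem isClosed_frontier.measurableSet

/-- Off the cell polynomials of degree less than `2 L`, the photoacoustic integral is
exponentially small in a power of `L`. -/
theorem exists_photoacousticIntegral_bound (hΩ : IsBoundedLipschitzDomain Ω) (hε : 0 < ε)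
    (hκ : IsStrongAttenuationCoefficient κ β) {N : ℕ} (hN : HasGrowthExponent κ N) :
    ∃ (c : SimpleFunc E3 E3) (K : ℝ), 0 < K ∧ ∃ b : ℝ, 0 < b ∧ ∀ (L : ℕ) (h : SourceSpace Ω ε),
      h ∈ (cellPolynomialSpace hΩ ε c (2 * L))ᗮ → ∀ (ω : ℝ), ∀ ξ ∈ frontier Ω,
      ‖photoacousticIntegral κ Ω ε h ω ξ‖ ≤
        K * Real.exp (-(b * (L : ℝ) ^ (β / N))) * ‖h‖ * (1 + ω ^ 2)⁻¹ := by
  obtain ⟨D, hD, hDb⟩ := exists_norm_sub_le (ε := ε) hΩ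
  obtain ⟨A, hA0, hA⟩ := exists_integral_norm_le hΩ ε
  obtain ⟨K, hK, b, hb, hdich⟩ := hκ.dichotomy hN hε hD
  obtain ⟨c, hc⟩ := exists_simpleFunc_dist_le
    ((isBounded_innerDomain (ε := ε) hΩ).isCompact_closure.totallyBounded.subset subset_closure)
    -- As `r₀ > ε`, the mesh `ε / 12` gives `|r² - r₀²| ≤ (25/144) r₀² < r₀² / 4`. The partition is
    -- chosen before `L`, `ω` and `ξ`.
    (show 0 < ε / 12 by positivity)
  refine ⟨c, 4 / ε * K * A, by positivity, b, hb, fun L h hh ω ξ hξ => ?_⟩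
  have hint := integrable_kernel_mul hΩ hε (hκ.im_nonneg ω) hξ h
  have hw : 0 < (1 + ω ^ 2)⁻¹ := by positivity
  suffices hs : ‖photoacousticIntegral κ Ω ε h ω ξ‖ ≤
      4 / ε * (K * Real.exp (-(b * (L : ℝ) ^ (β / N))) * (1 + ω ^ 2)⁻¹) * (A * ‖h‖) from
    hs.trans (le_of_eq (by ring))
  rcases hdich L ω with hcase | hcase
  -- Low frequency: expand on each cell about the distance from `ξ` to its centre, which lies in
  -- `Ω_ε`, so that `r₀ > ε`.
  · choose! a ha using fun (r₀ : ℝ) (hr₀ : 0 < r₀) => exists_kernel_approx (κ ω) hr₀ L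
    refine norm_photoacousticIntegral_le hΩ hA (by positivity) (integral_cellPolynomial_mul_eq_zero
      hΩ hh (sqDist_mem_cellPolynomials c ξ L fun p => a ‖ξ - p‖)) hint fun y hy => ?_
    obtain ⟨hcy, hdist⟩ := hc y hy
    have hr₀ := lt_norm_sub_of_mem_innerDomain hcy hξ
    have hrD := hDb _ hcy ξ hξ
    have hdiff : |‖ξ - y‖ - ‖ξ - c y‖| ≤ ε / 12 := by
      refine (abs_norm_sub_norm_le _ _).trans ?_
      rw [sub_sub_sub_cancel_left, ← dist_eq_norm]
      exact hdist
    set r := ‖ξ - y‖ with hr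
    set r₀ := ‖ξ - c y‖ with hr₀'
    have hsq : |r ^ 2 - r₀ ^ 2| ≤ r₀ ^ 2 / 4 := by
      rw [abs_le] at hdiff ⊢
      constructor <;> nlinarith
    refine (ha r₀ (hε.trans hr₀) r (norm_nonneg _) hsq).trans ?_
    rw [mul_assoc]
    refine mul_le_mul ?_ (le_trans ?_ hcase) (by positivity) (by positivity)
    · exact div_le_div_of_nonneg_left (by norm_num) hε hr₀.le
    · gcongr
  -- High frequency: the kernel itself is small, so the approximant `T = 0` suffices.
  · refine norm_photoacousticIntegral_le hΩ hA (by positivity) (T := 0) (by simp) hint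
      fun y hy => ?_
    rw [Pi.zero_apply, sub_zero]
    refine (norm_kernel_le (hκ.im_nonneg ω) hε (lt_norm_sub_of_mem_innerDomain hy hξ).le).trans ?_
    rw [div_eq_mul_inv, mul_comm]
    refine mul_le_mul ?_ hcase (Real.exp_pos _).le (by positivity)
    rw [← one_div]
    gcongr
    norm_num

theorem photoacousticIntegral_add (hΩ : IsBoundedLipschitzDomain Ω) (hε : 0 < ε) {ω : ℝ}
    (hk : 0 ≤ (κ ω).im) {ξ : E3} (hξ : ξ ∈ frontier Ω) (f g : SourceSpace Ω ε) :
    photoacousticIntegral κ Ω ε (f + g : SourceSpace Ω ε) ω ξ =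
      photoacousticIntegral κ Ω ε f ω ξ + photoacousticIntegral κ Ω ε g ω ξ := by
  unfold photoacousticIntegral
  rw [← mul_add, ← integral_add (integrable_kernel_mul hΩ hε hk hξ f)
    (integrable_kernel_mul hΩ hε hk hξ g)]
  congr 1
  refine integral_congr_ae ?_
  filter_upwards [Lp.coeFn_add f g] with y hy
  rw [hy, Pi.add_apply, mul_add]

theorem photoacousticIntegral_smul (a : ℂ) (f : SourceSpace Ω ε) (ω : ℝ) (ξ : E3) :
    photoacousticIntegral κ Ω ε (a • f : SourceSpace Ω ε) ω ξ =
      a * photoacousticIntegral κ Ω ε f ω ξ := by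
  unfold photoacousticIntegral
  rw [mul_left_comm, ← integral_const_mul a]
  congr 1
  refine integral_congr_ae ?_
  filter_upwards [Lp.coeFn_smul a f] with y hy
  rw [hy, Pi.smul_apply, smul_eq_mul, mul_left_comm]

/-- A pointwise bound of the photoacoustic integral makes it a bounded operator. -/
theorem exists_isIntegratedPhotoacousticOperator (hΩ : IsBoundedLipschitzDomain Ω) (hε : 0 < ε)
    (hκc : Continuous κ) (hκ : ∀ ω, 0 ≤ (κ ω).im) {B : ℝ}
    (hB : ∀ (h : SourceSpace Ω ε) (ω : ℝ), ∀ ξ ∈ frontier Ω,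
      ‖photoacousticIntegral κ Ω ε h ω ξ‖ ≤ B * ‖h‖ * (1 + ω ^ 2)⁻¹) :
    ∃ P : SourceSpace Ω ε →L[ℂ] DataSpace Ω, IsIntegratedPhotoacousticOperator κ Ω ε P := by
  have hG := memLp_frequencyWeight hΩ
  have hfr := ae_snd_mem_frontier hΩ
  have hbd : ∀ h : SourceSpace Ω ε, ∀ᵐ q ∂((volume : Measure ℝ).prod (surfaceMeasure Ω)),
      ‖photoacousticIntegral κ Ω ε h q.1 q.2‖ ≤ B * ‖h‖ * ‖frequencyWeight q‖ := by
    intro h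
    filter_upwards [hfr] with q hq
    rw [Real.norm_of_nonneg (by unfold frequencyWeight; positivity)]
    exact hB h q.1 q.2 hq
  have hmem : ∀ h : SourceSpace Ω ε,
      MemLp (fun q : ℝ × E3 => photoacousticIntegral κ Ω ε h q.1 q.2) 2
        ((volume : Measure ℝ).prod (surfaceMeasure Ω)) := fun h =>
    hG.of_le_mul (stronglyMeasurable_photoacousticIntegral hΩ hκc h).aestronglyMeasurable (hbd h)
  let P₀ : SourceSpace Ω ε →ₗ[ℂ] DataSpace Ω :=
    { toFun := fun h => (hmem h).toLp
      map_add' := by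
        intro f g
        rw [← MemLp.toLp_add]
        refine MemLp.toLp_congr _ _ ?_
        filter_upwards [hfr] with q hq
        exact photoacousticIntegral_add hΩ hε (hκ q.1) hq f g
      map_smul' := by
        intro a f
        rw [RingHom.id_apply, ← MemLp.toLp_const_smul]
        refine MemLp.toLp_congr _ _ (Filter.Eventually.of_forall fun q => ?_)
        exact photoacousticIntegral_smul a f q.1 q.2 }
  refine ⟨P₀.mkContinuous (B * ‖hG.toLp‖) fun h => ?_, fun h => (hmem h).coeFn_toLp⟩
  rw [mul_right_comm]
  refine Lp.norm_le_mul_norm_of_ae_le_mul ?_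
  filter_upwards [(hmem h).coeFn_toLp, hG.coeFn_toLp, hbd h] with q h1 h2 h3
  change ‖((hmem h).toLp : DataSpace Ω) q‖ ≤ _
  rwa [h1, h2]

theorem IsIntegratedPhotoacousticOperator.norm_apply_le (hΩ : IsBoundedLipschitzDomain Ω)
    {P : SourceSpace Ω ε →L[ℂ] DataSpace Ω} (hP : IsIntegratedPhotoacousticOperator κ Ω ε P)
    {h : SourceSpace Ω ε} {B : ℝ}
    (hB : ∀ (ω : ℝ), ∀ ξ ∈ frontier Ω,
      ‖photoacousticIntegral κ Ω ε h ω ξ‖ ≤ B * (1 + ω ^ 2)⁻¹) :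
    ‖P h‖ ≤ B * ‖(memLp_frequencyWeight hΩ).toLp‖ := by
  refine Lp.norm_le_mul_norm_of_ae_le_mul ?_
  filter_upwards [hP h, (memLp_frequencyWeight hΩ).coeFn_toLp, ae_snd_mem_frontier hΩ]
    with q h1 h2 h3
  rw [h1, h2, Real.norm_of_nonneg (by unfold frequencyWeight; positivity)]
  exact hB q.1 q.2 h3

end Operator

/-! ### From degree to index, and conclusion. -/

/-- A bound in terms of the degree turns into a bound in terms of the index, when the number of
polynomials grows like the cube of the degree. -/
theorem exists_index_bound {K b p : ℝ} (hK : 0 < K) (hb : 0 < b) (hp0 : 0 < p) (hp1 : p ≤ 1) (M : ℕ) :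
    ∃ C : ℝ, 0 < C ∧ ∃ c : ℝ, 0 < c ∧ ∀ n : ℕ, ∃ L : ℕ, M * (2 * L) ^ 3 ≤ n ∧
      K * Real.exp (-(b * (L : ℝ) ^ p)) ≤ C * Real.exp (-c * ((n : ℝ) + 1) ^ (p / 3)) := by
  set m : ℝ := 8 * (M + 1) with hm
  have hm0 : 0 < m := by positivity
  refine ⟨K * Real.exp b, by positivity, b / m ^ (p / 3), by positivity, fun n => ?_⟩
  -- `M + 1` instead of `M` keeps the admissible `L` bounded when `M = 0`, and then the search range
  -- `n` is sufficient. Maximality gives `n + 1 ≤ m (L + 1)³`.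
  set L := Nat.findGreatest (fun L => (M + 1) * (2 * L) ^ 3 ≤ n) n with hL
  have h1 : (M + 1) * (2 * L) ^ 3 ≤ n :=
    Nat.findGreatest_spec (P := fun L => (M + 1) * (2 * L) ^ 3 ≤ n) (Nat.zero_le n) (by simp)
  have h2 : n < (M + 1) * (2 * (L + 1)) ^ 3 := by
    by_contra! hle
    have hLn : L + 1 ≤ n := by
      refine le_trans ?_ hle
      nlinarith [Nat.zero_le M, Nat.zero_le L, Nat.zero_le (L ^ 2), Nat.zero_le (L ^ 3),
        Nat.zero_le (M * (2 * (L + 1)) ^ 3)]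
    have := Nat.le_findGreatest (P := fun L => (M + 1) * (2 * L) ^ 3 ≤ n) hLn hle
    omega
  refine ⟨L, le_trans (Nat.mul_le_mul_right _ (Nat.le_succ M)) h1, ?_⟩
  have h3 : (n : ℝ) + 1 ≤ m * ((L : ℝ) + 1) ^ 3 := by
    have : ((n + 1 : ℕ) : ℝ) ≤ (((M + 1) * (2 * (L + 1)) ^ 3 : ℕ) : ℝ) := by exact_mod_cast h2
    push_cast at this
    rw [hm]
    linarith
  have h4 : ((n : ℝ) + 1) ^ (p / 3) ≤ m ^ (p / 3) * ((L : ℝ) + 1) ^ p := by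
    calc ((n : ℝ) + 1) ^ (p / 3) ≤ (m * ((L : ℝ) + 1) ^ 3) ^ (p / 3) := by gcongr
      _ = m ^ (p / 3) * ((L : ℝ) + 1) ^ p := by
          rw [Real.mul_rpow hm0.le (by positivity), ← Real.rpow_natCast, ← Real.rpow_mul (by positivity)]
          congr 2
          push_cast
          ring
  -- Subadditivity of `x ↦ x ^ p` for `p ≤ 1` replaces `L + 1` by `L`, at the cost of the factor
  -- `exp b` in the constant.
  have h5 : ((L : ℝ) + 1) ^ p ≤ (L : ℝ) ^ p + 1 := by
    have := Real.rpow_add_le_add_rpow (p := p) (a := (L : ℝ)) (b := 1) (by positivity) (by norm_num)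
      hp0.le hp1
    rwa [Real.one_rpow] at this
  rw [mul_assoc, ← Real.exp_add]
  gcongr
  have h6 : b / m ^ (p / 3) * ((n : ℝ) + 1) ^ (p / 3) ≤ b * ((L : ℝ) ^ p + 1) := by
    calc _ ≤ b / m ^ (p / 3) * (m ^ (p / 3) * ((L : ℝ) + 1) ^ p) := by gcongr
      _ = b * ((L : ℝ) + 1) ^ p := by field_simp
      _ ≤ _ := by gcongr
  linarith

end AttenuatedPhotoacoustics

end

/-- For a strong attenuation coefficient, the eigenvalues `λ₁ ≥ λ₂ ≥ …` of `P* P`, where `P` is the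
integrated photoacoustic operator, decay exponentially. Here `lam n` is `λ_{n+1}`. -/
theorem mainTheorem2
    (Ω : Set AttenuatedPhotoacoustics.E3)
    (hΩ : AttenuatedPhotoacoustics.IsBoundedLipschitzDomain Ω)
    (ε : ℝ) (hε : 0 < ε)
    (κ : ℝ → ℂ) (β : ℝ)
    (hκ : AttenuatedPhotoacoustics.IsStrongAttenuationCoefficient κ β)
    (N : ℕ) (hN : AttenuatedPhotoacoustics.HasGrowthExponent κ N) :
    ∃ P : AttenuatedPhotoacoustics.SourceSpace Ω ε →L[ℂ] AttenuatedPhotoacoustics.DataSpace Ω,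
      AttenuatedPhotoacoustics.IsIntegratedPhotoacousticOperator κ Ω ε P ∧
      IsCompactOperator (ContinuousLinearMap.adjoint P ∘L P) ∧
      ∃ lam : ℕ → ℝ,
        AttenuatedPhotoacoustics.IsEigenvalueSequence (ContinuousLinearMap.adjoint P ∘L P) lam ∧
        ∃ C : ℝ, 0 < C ∧ ∃ c : ℝ, 0 < c ∧ ∀ n : ℕ,
          lam n ≤ C * ((n : ℝ) + 1) * ((n : ℝ) + 1) ^ ((1 : ℝ) / 3) *
            Real.exp (-c * ((n : ℝ) + 1) ^ (β / ((N : ℝ) * 3))) := by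
  open AttenuatedPhotoacoustics in
  have hβ := hκ.exponent_pos
  have hβN := hκ.exponent_le hN
  have hN0 : (0 : ℝ) < N := hβ.trans_le hβN
  have hp0 : 0 < β / N := by positivity
  have hp1 : β / N ≤ 1 := (div_le_one hN0).2 hβN
  obtain ⟨c, K, hK, b, hb, hbound⟩ := exists_photoacousticIntegral_bound hΩ hε hκ hN
  obtain ⟨P, hP⟩ := exists_isIntegratedPhotoacousticOperator hΩ hε hκ.smooth.continuous
    hκ.im_nonneg (B := K) (fun h ω ξ hξ => by
      -- For `L = 0` the test space is trivial, so the decay estimate covers every `h` and gives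
      -- boundedness.
      have h0 : h ∈ (cellPolynomialSpace hΩ ε c (2 * 0))ᗮ := by
        have : cellPolynomialSpace hΩ ε c (2 * 0) = ⊥ := by
          unfold cellPolynomialSpace
          rw [Submodule.span_eq_bot]
          rintro _ ⟨j, rfl⟩
          exact (j.2 0).elim0
        rw [this, Submodule.bot_orthogonal_eq_top]
        exact Submodule.mem_top
      simpa [Real.zero_rpow hp0.ne'] using hbound 0 h h0 ω ξ hξ)
  set g := ‖(memLp_frequencyWeight hΩ).toLp‖ with hg
  set A := (K * (g + 1)) ^ 2 with hA
  have hA0 : 0 < A := by positivity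
  have hdecay : ∀ L : ℕ, ∀ h ∈ (cellPolynomialSpace hΩ ε c (2 * L))ᗮ,
      ‖P h‖ ^ 2 ≤ A * Real.exp (-(2 * b * (L : ℝ) ^ (β / N))) * ‖h‖ ^ 2 := by
    intro L h hh
    have h1 := hP.norm_apply_le hΩ (hbound L h hh)
    rw [← hg] at h1
    have h2 : ‖P h‖ ≤ K * (g + 1) * Real.exp (-(b * (L : ℝ) ^ (β / N))) * ‖h‖ := by
      refine h1.trans ?_
      have : 0 ≤ K * Real.exp (-(b * (L : ℝ) ^ (β / N))) * ‖h‖ := by positivity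
      linarith
    refine (pow_le_pow_left₀ (norm_nonneg _) h2 2).trans (le_of_eq ?_)
    rw [mul_pow, mul_pow, ← Real.exp_nat_mul, hA]
    congr 3
    push_cast
    ring
  have happrox : ∀ t : ℝ, 0 < t → ∃ V : Submodule ℂ (SourceSpace Ω ε), FiniteDimensional ℂ V ∧
      ∀ h ∈ Vᗮ, ‖P h‖ ^ 2 ≤ t * ‖h‖ ^ 2 := by
    intro t ht
    have hlim : Filter.Tendsto (fun L : ℕ => A * Real.exp (-(2 * b * (L : ℝ) ^ (β / N))))
        Filter.atTop (nhds (A * 0)) := by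
      refine (Real.tendsto_exp_neg_atTop_nhds_zero.comp ?_).const_mul A
      exact ((tendsto_rpow_atTop hp0).comp tendsto_natCast_atTop_atTop).const_mul_atTop
        (by positivity)
    rw [mul_zero] at hlim
    obtain ⟨L, hL⟩ := (hlim.eventually_lt_const ht).exists
    exact ⟨cellPolynomialSpace hΩ ε c (2 * L), inferInstance, fun h hh =>
      (hdecay L h hh).trans (by gcongr)⟩
  obtain ⟨lam, hlam, hle⟩ := exists_isEigenvalueSequence P happrox
  refine ⟨P, hP, (isCompactOperator_of_finiteDimensional_approx P happrox).clm_comp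
    (ContinuousLinearMap.adjoint P),
    lam, hlam, ?_⟩
  obtain ⟨C, hC, d, hd, hidx⟩ := exists_index_bound hA0 (show 0 < 2 * b by positivity) hp0 hp1
    c.range.card
  refine ⟨C, hC, d, hd, fun n => ?_⟩
  obtain ⟨L, hLn, hLb⟩ := hidx n
  have h1 := hle n _ (cellPolynomialSpace hΩ ε c (2 * L)) (by positivity) inferInstance
    ((finrank_cellPolynomialSpace_le hΩ c (2 * L)).trans hLn) (hdecay L)
  refine h1.trans (hLb.trans ?_)
  rw [div_div]
  have hn : (1 : ℝ) ≤ (n : ℝ) + 1 := by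
    have := Nat.cast_nonneg (α := ℝ) n
    linarith
  -- The estimate obtained is pure exponential decay; the factor `(n + 1)^(4/3) ≥ 1` is only
  -- inserted.
  have h2 : (1 : ℝ) ≤ ((n : ℝ) + 1) ^ ((1 : ℝ) / 3) := Real.one_le_rpow hn (by norm_num)
  gcongr
  rw [mul_assoc]
  exact le_mul_of_one_le_right hC.le (one_le_mul_of_one_le_of_one_le hn h2)
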